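/- Let $\mathbb T=\mathbb R/\mathbb Z$ with Lebesgue measure, let $\mathcal P(\mathbb T)$ be the set of Borel probability measures on $\mathbb T$, and let $q_u\equiv 1$ be the uniform distribution. For $\beta>0$ let $$W_\beta(\theta)=\frac{e^{\beta\cos 2\pi\theta}-1}{\beta},$$ and for $K\ge 0$ and $q\in\mathcal P(\mathbb T)$ let $$\mathcal F_{K}(q)=\int_{\mathbb T}\log q\,dq-K\iint_{\mathbb T\times\mathbb T}W_\beta(\theta-\theta')\,dq(\theta)\,dq(\theta')\in(-\infty,\infty],$$ where the first term is the relative entropy of $q$ with respect to $q_u$ (equal to $+\infty$ if $q$ is not absolutely continuous or $q\log q$ is not integrable). A minimizer always means a global minimizer of $\mathcal F_K$ over $\mathcal P(\mathbb T)$. The critical coupling $K_c(\beta)$ is the number $K_c>0$ such that $q_u$ is the unique minimizer of $\mathcal F_K$ for $0\le K<K_c$, $q_u$ is a minimizer of $\mathcal F_{K_c}$, and $\mathcal F_K$ has a minimizer $q\ne q_u$ for every $K>K_c$. The phase transition is continuous if the minimizer of $\mathcal F_{K_c}$ is unique and $\limsup_{K\to K_c+}\|q_K-q_u\|_{L^1}=0$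 for every family $(q_K)_{K>K_c}$ of minimizers $q_K$ of $\mathcal F_K$; otherwise it is discontinuous. The linear stability threshold is $K_\#(\beta)=1/(2\max\widehat{W_\beta}(k))$, where $\widehat{W_\beta}(k)=\int_{\mathbb T}W_\beta(\theta)e^{-2\pi ik\theta}\,d\theta$ and the maximum is over the integers $k\ge1$ with $\widehat{W_\beta}(k)>0$. Let $I_n(x)=\sum_{k\ge0}\frac{(x/2)^{2k+n}}{k!\,(k+n)!}$ be the modified Bessel functions of the first kind. **Theorem 1.6.** The equation $I_2(\beta)=\tfrac12I_1(\beta)$ has a unique solution $\beta_*$ in $(0,\infty)$. For every $\beta>0$ the critical coupling $K_c(\beta)$ exists, $K_\#(\beta)=\dfrac{\beta}{2I_1(\beta)}$, and 1. if $\beta\le\beta_*$, the phase transition is continuous and $K_c(\beta)=K_\#(\beta)$; 2. if $\beta>\beta_*$, the phase transition is discontinuous and $K_c(\beta)<K_\#(\beta)$. -/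

import Mathlib

open MeasureTheory Filter Topology

namespace MeanFieldCircle

noncomputable section

/-- The modified Bessel function of the first kind of integer order,
`I_n(x) = ∑_{k ≥ 0} (x / 2) ^ (2 k + n) / (k! (k + n)!)`. -/
def besselI (n : ℕ) (x : ℝ) : ℝ :=
  ∑' k : ℕ, (x / 2) ^ (2 * k + n) / ((k.factorial : ℝ) * ((k + n).factorial : ℝ))

lemma periodic_cos_two_pi : Function.Periodic (fun t : ℝ => Real.cos (2 * Real.pi * t)) 1 := by
  intro t
  simp only [mul_add, mul_one]
  exact Real.cos_periodic _

/-- The function `θ ↦ cos (2 π θ)` on the circle `ℝ / ℤ`. -/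
def cosTwoPi : UnitAddCircle → ℝ := periodic_cos_two_pi.lift

lemma continuous_cosTwoPi : Continuous cosTwoPi := by
  refine continuous_coinduced_dom.mpr ?_
  change Continuous (fun t : ℝ => Real.cos (2 * Real.pi * t))
  fun_prop

/-- The noisy transformer interaction `W_β(θ) = (exp (β cos (2 π θ)) - 1) / β`. -/
def transformerKernel (β : ℝ) : C(UnitAddCircle, ℝ) where
  toFun θ := (Real.exp (β * cosTwoPi θ) - 1) / β
  continuous_toFun := by
    have := continuous_cosTwoPi
    fun_prop

/-- The uniform distribution `q_u` on the circle (Lebesgue measure, of total mass one). -/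
def uniform : ProbabilityMeasure UnitAddCircle := ⟨volume, ⟨UnitAddCircle.measure_univ⟩⟩

/-- The interaction energy `∬ W(θ - θ') dq(θ) dq(θ')`. -/
def interactionEnergy (W : C(UnitAddCircle, ℝ)) (q : ProbabilityMeasure UnitAddCircle) : ℝ :=
  ∫ θ, ∫ θ', W (θ - θ') ∂(q : Measure UnitAddCircle) ∂(q : Measure UnitAddCircle)

/-- The free energy `F_K(q) = ∫ log q dq - K ∬ W(θ - θ') dq(θ) dq(θ')`. The entropy is the
relative entropy of `q` with respect to the uniform distribution; it is `+∞` if `q` is not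
absolutely continuous or if `q log q` is not integrable. -/
def freeEnergy (W : C(UnitAddCircle, ℝ)) (K : ℝ) (q : ProbabilityMeasure UnitAddCircle) : EReal :=
  ((InformationTheory.klDiv (q : Measure UnitAddCircle) volume : ENNReal) : EReal)
    - ((K * interactionEnergy W q : ℝ) : EReal)

/-- `q` is a global minimizer of the free energy `F_K` over all Borel probability measures. -/
def IsGlobalMinimizer (W : C(UnitAddCircle, ℝ)) (K : ℝ)
    (q : ProbabilityMeasure UnitAddCircle) : Prop :=
  ∀ p : ProbabilityMeasure UnitAddCircle, freeEnergy W K q ≤ freeEnergy W K p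

/-- `Kc` is the critical coupling `K_c`: for `0 ≤ K < Kc` the uniform distribution is the unique
global minimizer, at `Kc` it is still a global minimizer, and for `K > Kc` there is a nonuniform
global minimizer. -/
structure IsCriticalCoupling (W : C(UnitAddCircle, ℝ)) (Kc : ℝ) : Prop where
  pos : 0 < Kc
  subcritical : ∀ K : ℝ, 0 ≤ K → K < Kc →
    ∀ q : ProbabilityMeasure UnitAddCircle, IsGlobalMinimizer W K q ↔ q = uniform
  critical : IsGlobalMinimizer W Kc uniform
  supercritical : ∀ K : ℝ, Kc < K →
    ∃ q : ProbabilityMeasure UnitAddCircle, q ≠ uniform ∧ IsGlobalMinimizer W K q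

/-- The norm `‖q - q_u‖_{L¹}` of the difference of the densities of `q` and `q_u`, for absolutely
continuous `q` (every global minimizer of a free energy is absolutely continuous). -/
def l1DistUniform (q : ProbabilityMeasure UnitAddCircle) : ENNReal :=
  eLpNorm (fun θ => ((q : Measure UnitAddCircle).rnDeriv volume θ).toReal - 1) 1 volume

/-- The phase transition at `Kc` is continuous: the global minimizer at `Kc` is unique, and for
every family of global minimizers `q_K`, `K > Kc`, one has
`limsup_{K → Kc +} ‖q_K - q_u‖_{L¹} = 0`. Otherwise it is discontinuous. -/
def IsContinuousTransition (W : C(UnitAddCircle, ℝ)) (Kc : ℝ) : Prop :=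
  (∃! q : ProbabilityMeasure UnitAddCircle, IsGlobalMinimizer W Kc q) ∧
  ∀ q : ℝ → ProbabilityMeasure UnitAddCircle,
    (∀ K : ℝ, Kc < K → IsGlobalMinimizer W K (q K)) →
      limsup (fun K => l1DistUniform (q K)) (𝓝[>] Kc) = 0

/-- The Fourier coefficient `Ŵ(k) = ∫ W(θ) exp (-2 π i k θ) dθ` (real for even `W`). -/
def fourierMode (W : C(UnitAddCircle, ℝ)) (k : ℕ) : ℝ :=
  (fourierCoeff (fun θ : UnitAddCircle => ((W θ : ℝ) : ℂ)) (k : ℤ)).re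

/-- `K` is the linear stability threshold `K_# = 1 / (2 max Ŵ(k))`, the maximum being over all
`k ≥ 1` with `Ŵ(k) > 0`. -/
def IsLinearStabilityThreshold (W : C(UnitAddCircle, ℝ)) (K : ℝ) : Prop :=
  ∃ m : ℝ, IsGreatest {x : ℝ | ∃ k : ℕ, 1 ≤ k ∧ 0 < fourierMode W k ∧ x = fourierMode W k} m ∧
    K = 1 / (2 * m)

end

end MeanFieldCircle

/-!
Write `q̂(k)` for the Fourier coefficients of a probability measure `q` and `c_k = I_k(β) / I_1(β)`.
The Fourier coefficients of the kernel are `I_k(β) / β`, so at the coupling `K = β / (2 I_1(β))` the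
free energy is, up to a constant, `H(q) - ∑_{k ≥ 1} c_k |q̂(k)|²`, where `H` is the relative entropy.

*Subcritical side.* The logarithmic Hardy-Littlewood-Sobolev inequality
`∑_{k ≥ 1} |q̂(k)|² / k ≤ H(q)` (`sum_mode_sq_div_le_entropy`) is dual, through the Gibbs variational
principle, to the Lebedev-Milin inequality for `exp φ`, which is proved by Milin's majorant of the
Taylor coefficients (`norm_expCoeff_sq_le`). By Turán's inequality the ratios `I_{k+1} / I_k` decrease
in `k`, so `c_2 ≤ 1/2` forces `c_k ≤ 2^{1-k} ≤ 1/k`, and the uniform distribution is a minimizer at the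
linear threshold. It is the only one, because `2^{1-k} < 1/k` for `k ≥ 3` while the Lebedev-Milin
inequality is strict for nonconstant polynomials of degree at most two
(`isGlobalMinimizer_iff_eq_uniform`).

*Supercritical side.* If `c_2 > 1/2`, the extremals `φ = x z + x² z² / 2 + ⋯` of the Lebedev-Milin
inequality, cut off after the second mode, show that the uniform distribution is not a minimizer at
the linear threshold (`not_isGlobalMinimizer_uniform_of_threshold`). So the critical coupling is
smaller, and there the uniform distribution is isolated among the minimizers
(`quad_le_entropy_of_small`, `not_isContinuousTransition`).

The case distinction is governed by `I_2 / I_1`, which is strictly increasing because its derivative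
is controlled by a quantity whose own derivative is a Turán determinant (`besselG_wronskian_pos`).

*Minimizers.* Since the kernel is positive definite, minimizing the free energy amounts to minimizing
a dual functional of the Fourier coefficients alone (`reducedEnergy_eq`). That functional is
continuous on a compact product of discs, which gives the existence of minimizers, the critical
coupling, and the continuity of the transition where the minimizer is unique.
-/

namespace MeanFieldCircle

open InformationTheory ComplexConjugate

noncomputable section

/-! ### Modified Bessel functions -/

/-- The entire series `G_n(u) = ∑ u ^ k / (k! (k + n)!)`, which is the modified Bessel function
with its leading power removed: `I_n(x) = (x / 2) ^ n * G_n((x / 2) ^ 2)`. -/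
def besselG (n : ℕ) (u : ℝ) : ℝ :=
  ∑' k : ℕ, u ^ k / ((k.factorial : ℝ) * ((k + n).factorial : ℝ))

lemma besselG_term_le (n k : ℕ) {u r : ℝ} (hu : |u| ≤ r) :
    ‖u ^ k / ((k.factorial : ℝ) * ((k + n).factorial : ℝ))‖ ≤
      r ^ k / k.factorial / n.factorial := by
  have hr : 0 ≤ r := (abs_nonneg u).trans hu
  rw [norm_div, norm_pow, Real.norm_eq_abs, Real.norm_of_nonneg (by positivity), div_div]
  have : n.factorial ≤ (k + n).factorial := Nat.factorial_le (by omega)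
  gcongr

lemma summable_besselG (n : ℕ) (u : ℝ) :
    Summable fun k : ℕ => u ^ k / ((k.factorial : ℝ) * ((k + n).factorial : ℝ)) :=
  Summable.of_norm_bounded ((Real.summable_pow_div_factorial |u|).div_const _)
    fun k => besselG_term_le n k le_rfl

lemma besselG_le (n : ℕ) {u : ℝ} (hu : 0 ≤ u) : besselG n u ≤ Real.exp u / n.factorial := by
  have h : HasSum (fun k : ℕ => u ^ k / k.factorial / n.factorial)
      (Real.exp u / n.factorial) := by
    have := NormedSpace.expSeries_div_hasSum_exp u
    rw [← Real.exp_eq_exp_ℝ] at this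
    exact this.div_const _
  refine (summable_besselG n u).tsum_le_of_sum_le fun s => ?_
  refine (Finset.sum_le_sum fun k _ => ?_).trans (h.summable.sum_le_tsum s fun k _ => by positivity)
    |>.trans_eq h.tsum_eq
  exact (le_abs_self _).trans (besselG_term_le n k (abs_of_nonneg hu).le)

lemma besselG_pos (n : ℕ) {u : ℝ} (hu : 0 ≤ u) : 0 < besselG n u :=
  (summable_besselG n u).tsum_pos (fun k => by positivity) 0 (by positivity)

lemma besselG_zero (n : ℕ) : besselG n 0 = 1 / n.factorial := by
  rw [besselG, tsum_eq_single 0 (fun k hk => by simp [hk])]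
  simp

lemma besselI_eq (n : ℕ) (x : ℝ) : besselI n x = (x / 2) ^ n * besselG n ((x / 2) ^ 2) := by
  rw [besselI, besselG, ← tsum_mul_left]
  refine tsum_congr fun k => ?_
  rw [pow_add, pow_mul]
  ring

lemma besselG_recurrence (n : ℕ) (u : ℝ) :
    besselG n u = (n + 1) * besselG (n + 1) u + u * besselG (n + 2) u := by
  have e : ∀ m, besselG m u = 1 / m.factorial +
      ∑' k : ℕ, u ^ (k + 1) / (((k + 1).factorial : ℝ) * ((k + 1 + m).factorial : ℝ)) := by
    intro m
    rw [besselG, (summable_besselG m u).tsum_eq_zero_add]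
    simp
  have hs := (summable_nat_add_iff 1).2 (summable_besselG (n + 1) u)
  rw [e n, e (n + 1), besselG, mul_add, ← tsum_mul_left, ← tsum_mul_left, add_assoc,
    ← (hs.mul_left _).tsum_add ((summable_besselG (n + 2) u).mul_left u)]
  congr 1
  · rw [Nat.factorial_succ]; push_cast; field_simp
  · refine tsum_congr fun k => ?_
    rw [show k + 1 + (n + 1) = (k + 1 + n) + 1 by ring, show k + (n + 2) = (k + 1 + n) + 1 by ring,
      Nat.factorial_succ (k + 1 + n), Nat.factorial_succ k]
    push_cast
    field_simp
    ring

lemma hasDerivAt_besselG (n : ℕ) (u : ℝ) : HasDerivAt (besselG n) (besselG (n + 1) u) u := by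
  set r : ℝ := |u| + 1
  set g' : ℕ → ℝ → ℝ := fun k y =>
    (k * y ^ (k - 1)) / ((k.factorial : ℝ) * ((k + n).factorial : ℝ)) with hg'
  have hstep : ∀ (k : ℕ) (y : ℝ), g' (k + 1) y =
      y ^ k / ((k.factorial : ℝ) * ((k + (n + 1)).factorial : ℝ)) := by
    intro k y
    simp only [hg', Nat.factorial_succ k, Nat.add_sub_cancel,
      show k + 1 + n = k + (n + 1) by ring]
    push_cast
    field_simp
  have key : HasDerivAt (besselG n) (∑' k, g' k u) u := by
    set v : ℕ → ℝ := fun k => Nat.casesOn k 0 fun j => r ^ j / j.factorial / (n + 1).factorial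
      with hv
    refine hasDerivAt_tsum_of_isPreconnected (u := v) (t := Set.Ioo (-r) r) (y₀ := u)
      ?_ isOpen_Ioo isPreconnected_Ioo ?_ ?_ ?_ (summable_besselG n u) ?_
    · rw [← summable_nat_add_iff 1]
      exact (Real.summable_pow_div_factorial r).div_const _
    · intro k y _
      exact (hasDerivAt_pow k y).div_const _
    · intro k y hy
      cases k with
      | zero => simp [hg', hv]
      | succ k =>
        rw [hstep]
        exact besselG_term_le (n + 1) k (abs_lt.2 hy).le
    all_goals exact abs_lt.1 (lt_add_one _)
  convert key using 1
  rw [Summable.tsum_eq_zero_add]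
  · simp only [hstep]; simp [hg', besselG]
  · rw [← summable_nat_add_iff 1]
    simp only [hstep]
    exact summable_besselG (n + 1) u

/-- Two steps of the recurrence express the Turán determinant of order `n` through the one of
order `n + 2` with a positive remainder. -/
lemma turan_step (n : ℕ) (u : ℝ) :
    besselG (n + 1) u ^ 2 - besselG n u * besselG (n + 2) u =
      (n + 2) * besselG (n + 2) u ^ 2 +
        u ^ 2 * (besselG (n + 3) u ^ 2 - besselG (n + 2) u * besselG (n + 4) u) := by
  have h0 := besselG_recurrence n u
  have h1 := besselG_recurrence (n + 1) u
  have h2 := besselG_recurrence (n + 2) u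
  push_cast at h1 h2
  have e1 : n + 1 + 1 = n + 2 := rfl
  have e2 : n + 1 + 2 = n + 3 := rfl
  have e3 : n + 2 + 1 = n + 3 := rfl
  have e4 : n + 2 + 2 = n + 4 := rfl
  rw [e1, e2] at h1
  rw [e3, e4] at h2
  rw [h0, h1]
  linear_combination (-(u * besselG (n + 2) u)) * h2

/-- Turán's inequality for modified Bessel functions. -/
lemma turan (n : ℕ) {u : ℝ} (hu : 0 ≤ u) :
    besselG n u * besselG (n + 2) u ≤ besselG (n + 1) u ^ 2 := by
  have lower : ∀ m n : ℕ,
      u ^ (2 * m) * (besselG (n + 2 * m + 1) u ^ 2 -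
        besselG (n + 2 * m) u * besselG (n + 2 * m + 2) u) ≤
      besselG (n + 1) u ^ 2 - besselG n u * besselG (n + 2) u := by
    intro m
    induction m with
    | zero => intro n; simp
    | succ m ih =>
      intro n
      have h := ih (n + 2)
      rw [turan_step n u, show n + 2 * (m + 1) = n + 2 + 2 * m by ring,
        show 2 * (m + 1) = 2 + 2 * m by ring, pow_add, mul_assoc]
      have h2 := mul_le_mul_of_nonneg_left h (sq_nonneg u)
      have h3 : (0 : ℝ) ≤ (n + 2) * besselG (n + 2) u ^ 2 := by positivity
      linarith
  -- the factorial decay of `besselG` in the order beats the factor `u ^ (2 m)`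
  have lim : Tendsto (fun m : ℕ => -(Real.exp u ^ 2 * (u ^ (2 * m) / (2 * m).factorial))) atTop
      (𝓝 0) := by
    have h := (FloorSemiring.tendsto_pow_div_factorial_atTop u).comp
      (tendsto_id.const_mul_atTop' (r := 2) two_pos)
    simpa using (h.const_mul (Real.exp u ^ 2)).neg
  refine sub_nonneg.1 (le_of_tendsto lim (Eventually.of_forall fun m => ?_))
  refine le_trans ?_ (lower m n)
  have a1 := besselG_le (n + 2 * m) hu
  have a2 := besselG_le (n + 2 * m + 2) hu
  have b1 : Real.exp u / (n + 2 * m).factorial ≤ Real.exp u / (2 * m).factorial := by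
    have := Nat.factorial_le (show 2 * m ≤ n + 2 * m by omega)
    gcongr
  have b2 : Real.exp u / (n + 2 * m + 2).factorial ≤ Real.exp u := by
    refine div_le_self (Real.exp_pos u).le ?_
    exact_mod_cast Nat.one_le_iff_ne_zero.2 (Nat.factorial_ne_zero _)
  have c := mul_le_mul (a1.trans b1) (a2.trans b2) (besselG_pos _ hu).le (by positivity)
  have d := mul_le_mul_of_nonneg_left c (pow_nonneg hu (2 * m))
  have e : 0 ≤ u ^ (2 * m) * besselG (n + 2 * m + 1) u ^ 2 := by positivity
  have f : u ^ (2 * m) * (Real.exp u / (2 * m).factorial * Real.exp u) =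
    Real.exp u ^ 2 * (u ^ (2 * m) / (2 * m).factorial) := by ring
  linarith

/-- Positivity of the quantity that controls the sign of the derivative of `I_2 / I_1`. Its
derivative is three times a Turán determinant. -/
lemma besselG_wronskian_pos {u : ℝ} (hu : 0 ≤ u) :
    0 < 2 * besselG 1 u ^ 2 - 3 * besselG 1 u * besselG 2 u - 2 * u * besselG 2 u ^ 2 := by
  set P : ℝ → ℝ := fun u =>
    2 * besselG 1 u ^ 2 - 3 * besselG 1 u * besselG 2 u - 2 * u * besselG 2 u ^ 2 with hP
  have hd : ∀ u, HasDerivAt P (3 * (besselG 2 u ^ 2 - besselG 1 u * besselG 3 u)) u := by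
    intro u
    have h1 := hasDerivAt_besselG 1 u
    have h2 := hasDerivAt_besselG 2 u
    have := (((h1.pow 2).const_mul 2).sub ((h1.const_mul 3).mul h2)).sub
      (((hasDerivAt_id u).const_mul 2).mul (h2.pow 2))
    refine this.congr_deriv ?_
    have r := besselG_recurrence 1 u
    norm_num at r ⊢
    linear_combination (4 * besselG 2 u) * r
  have mono : MonotoneOn P (Set.Ici 0) := by
    refine monotoneOn_of_deriv_nonneg (convex_Ici 0)
      (fun x _ => (hd x).continuousAt.continuousWithinAt)
      (fun x _ => (hd x).differentiableAt.differentiableWithinAt) fun x hx => ?_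
    rw [interior_Ici] at hx
    rw [(hd x).deriv]
    have := turan 1 (le_of_lt hx)
    norm_num at this
    linarith
  have h0 : P 0 = 1 / 2 := by simp [hP, besselG_zero]; norm_num
  have := mono (Set.mem_Ici.2 le_rfl) (Set.mem_Ici.2 hu) hu
  rw [h0] at this
  change 0 < P u
  linarith

/-- `I_2(2 t) / I_1(2 t)`. -/
def besselRatio (t : ℝ) : ℝ := t * besselG 2 (t ^ 2) / besselG 1 (t ^ 2)

lemma hasDerivAt_besselRatio (t : ℝ) :
    HasDerivAt besselRatio
      ((2 * besselG 1 (t ^ 2) ^ 2 - 3 * besselG 1 (t ^ 2) * besselG 2 (t ^ 2) -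
        2 * t ^ 2 * besselG 2 (t ^ 2) ^ 2) / besselG 1 (t ^ 2) ^ 2) t := by
  have hq : HasDerivAt (fun t : ℝ => t ^ 2) (2 * t) t := by simpa using hasDerivAt_pow 2 t
  have h1 := (hasDerivAt_besselG 1 (t ^ 2)).comp t hq
  have h2 := (hasDerivAt_besselG 2 (t ^ 2)).comp t hq
  have hne : besselG 1 (t ^ 2) ≠ 0 := (besselG_pos 1 (sq_nonneg t)).ne'
  have := ((hasDerivAt_id t).mul h2).div h1 hne
  refine this.congr_deriv ?_
  have r := besselG_recurrence 1 (t ^ 2)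
  simp only [Function.comp, id, Pi.mul_apply]
  norm_num at r ⊢
  congr 1
  linear_combination (-2 * besselG 1 (t ^ 2)) * r

lemma besselRatio_strictMonoOn : StrictMonoOn besselRatio (Set.Ici 0) := by
  refine strictMonoOn_of_deriv_pos (convex_Ici 0)
    (fun x _ => (hasDerivAt_besselRatio x).continuousAt.continuousWithinAt) fun x _ => ?_
  rw [(hasDerivAt_besselRatio x).deriv]
  exact div_pos (besselG_wronskian_pos (sq_nonneg x)) (pow_pos (besselG_pos 1 (sq_nonneg x)) 2)

lemma besselI_pos (n : ℕ) {x : ℝ} (hx : 0 < x) : 0 < besselI n x := by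
  rw [besselI_eq]
  exact mul_pos (by positivity) (besselG_pos n (sq_nonneg _))

lemma besselI_two_div_one {x : ℝ} (hx : 0 < x) :
    besselI 2 x / besselI 1 x = besselRatio (x / 2) := by
  have := besselG_pos 1 (sq_nonneg (x / 2))
  rw [besselI_eq, besselI_eq, besselRatio]
  field_simp

/-- Together with `lt_besselRatio_three` this brackets the crossing of the level `1 / 2`. -/
lemma besselRatio_one_lt : besselRatio 1 < 1 / 2 := by
  have r := besselG_recurrence 1 (1 ^ 2)
  have h1 := besselG_pos 1 (sq_nonneg (1 : ℝ))
  have h3 := besselG_pos 3 (sq_nonneg (1 : ℝ))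
  norm_num at r h1 h3
  rw [besselRatio]
  norm_num
  rw [div_lt_iff₀ h1]
  linarith

lemma lt_besselRatio_three : 1 / 2 < besselRatio 3 := by
  have r := besselG_recurrence 1 (3 ^ 2)
  have r2 := besselG_recurrence 2 (3 ^ 2)
  have h1 := besselG_pos 1 (sq_nonneg (3 : ℝ))
  have h3 := besselG_pos 3 (sq_nonneg (3 : ℝ))
  have h4 := besselG_pos 4 (sq_nonneg (3 : ℝ))
  norm_num at r r2 h1 h3 h4
  rw [besselRatio]
  norm_num
  rw [lt_div_iff₀ h1]
  linarith

/-- The ratio `I_2 / I_1` crosses the level `1 / 2` exactly once. -/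
lemma existsUnique_besselI_two_eq_half :
    ∃! b : ℝ, 0 < b ∧ besselI 2 b = 1 / 2 * besselI 1 b := by
  have hiff : ∀ b : ℝ, 0 < b →
      (besselI 2 b = 1 / 2 * besselI 1 b ↔ besselRatio (b / 2) = 1 / 2) := by
    intro b hb
    rw [← besselI_two_div_one hb, div_eq_iff (besselI_pos 1 hb).ne']
  obtain ⟨t, ht, hr⟩ := intermediate_value_Icc (show (1 : ℝ) ≤ 3 by norm_num)
    (fun x _ => (hasDerivAt_besselRatio x).continuousAt.continuousWithinAt)
    (Set.mem_Icc.2 ⟨besselRatio_one_lt.le, lt_besselRatio_three.le⟩)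
  have ht0 : 0 < t := by linarith [ht.1]
  refine ⟨2 * t, ⟨by positivity, (hiff _ (by positivity)).2 (by simpa using hr)⟩, ?_⟩
  rintro b ⟨hb, hb2⟩
  have := besselRatio_strictMonoOn.injOn (Set.mem_Ici.2 (half_pos hb).le) (Set.mem_Ici.2 ht0.le)
    (((hiff b hb).1 hb2).trans hr.symm)
  linarith

lemma besselI_turan (n : ℕ) {x : ℝ} :
    besselI n x * besselI (n + 2) x ≤ besselI (n + 1) x ^ 2 := by
  have := mul_le_mul_of_nonneg_left (turan n (sq_nonneg (x / 2)))
    (pow_nonneg (sq_nonneg (x / 2)) (n + 1))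
  simp only [besselI_eq]
  generalize x / 2 = y at *
  calc _ = (y ^ 2) ^ (n + 1) * (besselG n (y ^ 2) * besselG (n + 2) (y ^ 2)) := by ring
    _ ≤ _ := this
    _ = _ := by ring

/-- By Turán's inequality the ratios `I_{n+1} / I_n` decrease with the order, so `I_n` decays at
least geometrically. -/
lemma besselI_succ_le (k : ℕ) {x : ℝ} (hx : 0 < x) :
    besselI (k + 2) x ≤ besselI 2 x / besselI 1 x * besselI (k + 1) x := by
  induction k with
  | zero => rw [div_mul_cancel₀ _ (besselI_pos 1 hx).ne']
  | succ k ih =>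
    have h1 := besselI_pos (k + 1) hx
    have h2 := besselI_pos (k + 2) hx
    have t := besselI_turan (k + 1) (x := x)
    rw [show k + 1 + 2 = k + 3 by rfl, show k + 1 + 1 = k + 2 by rfl] at t ⊢
    refine le_of_mul_le_mul_left ?_ h1
    calc _ ≤ besselI (k + 2) x ^ 2 := t
      _ = besselI (k + 2) x * besselI (k + 2) x := sq _
      _ ≤ (besselI 2 x / besselI 1 x * besselI (k + 1) x) * besselI (k + 2) x := by gcongr
      _ = _ := by ring

lemma besselI_le_geometric (k : ℕ) {x : ℝ} (hx : 0 < x) :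
    besselI (k + 1) x ≤ besselI 1 x * (besselI 2 x / besselI 1 x) ^ k := by
  have h1 := besselI_pos 1 hx
  have h2 := besselI_pos 2 hx
  induction k with
  | zero => simp
  | succ k ih =>
    refine (besselI_succ_le k hx).trans ?_
    rw [pow_succ']
    calc _ ≤ besselI 2 x / besselI 1 x * (besselI 1 x * (besselI 2 x / besselI 1 x) ^ k) := by
          gcongr
      _ = _ := by ring

lemma besselI_two_lt_one {x : ℝ} (hx : 0 < x) : besselI 2 x < besselI 1 x := by
  have h0 := besselI_pos 0 hx
  have h1 := besselI_pos 1 hx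
  have h2 := besselI_pos 2 hx
  have t := besselI_turan 0 (x := x)
  have r : besselI 2 x < besselI 0 x := by
    have r := besselG_recurrence 0 ((x / 2) ^ 2)
    have := besselG_pos 1 (sq_nonneg (x / 2))
    simp only [besselI_eq]
    norm_num at r ⊢
    linarith
  norm_num at t
  nlinarith

lemma besselI_succ_le_one (k : ℕ) {x : ℝ} (hx : 0 < x) : besselI (k + 1) x ≤ besselI 1 x := by
  have h1 := besselI_pos 1 hx
  have h2 := besselI_pos 2 hx
  refine (besselI_le_geometric k hx).trans (mul_le_of_le_one_right h1.le ?_)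
  exact pow_le_one₀ (by positivity) ((div_le_one h1).2 (besselI_two_lt_one hx).le)

lemma summable_besselI_succ {x : ℝ} (hx : 0 < x) : Summable fun k : ℕ => besselI (k + 1) x := by
  have h1 := besselI_pos 1 hx
  have h2 := besselI_pos 2 hx
  exact Summable.of_nonneg_of_le (fun k => (besselI_pos _ hx).le)
    (fun k => besselI_le_geometric k hx)
    ((summable_geometric_of_lt_one (by positivity)
      ((div_lt_one h1).2 (besselI_two_lt_one hx))).mul_left _)

/-! ### Integrals and relative entropy on the circle -/

instance isProbabilityMeasure_volume_circle :
    IsProbabilityMeasure (volume : Measure UnitAddCircle) :=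
  ⟨UnitAddCircle.measure_univ⟩

lemma integrable_of_continuous {E : Type*} [NormedAddCommGroup E] {μ : Measure UnitAddCircle}
    [IsFiniteMeasure μ] {f : UnitAddCircle → E} (hf : Continuous f) : Integrable f μ :=
  hf.integrable_of_hasCompactSupport (HasCompactSupport.of_compactSpace f)

lemma hasSum_integral_of_norm_le {ι E : Type*} [Countable ι] [NormedAddCommGroup E]
    [NormedSpace ℝ E] (μ : Measure UnitAddCircle) [IsFiniteMeasure μ] {F : ι → UnitAddCircle → E}
    {u : ι → ℝ} (hF : ∀ i, Continuous (F i)) (hu : Summable u) (hb : ∀ i θ, ‖F i θ‖ ≤ u i) :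
    HasSum (fun i => ∫ θ, F i θ ∂μ) (∫ θ, ∑' i, F i θ ∂μ) := by
  refine hasSum_integral_of_summable_integral_norm (fun i => integrable_of_continuous (hF i)) ?_
  refine Summable.of_nonneg_of_le (fun i => integral_nonneg fun θ => norm_nonneg _) (fun i => ?_)
    (hu.mul_right (μ.real Set.univ))
  calc ∫ θ, ‖F i θ‖ ∂μ ≤ ∫ _, u i ∂μ :=
        integral_mono (integrable_of_continuous (hF i)).norm (integrable_const _) (hb i)
    _ = u i * μ.real Set.univ := by simp [mul_comm]

lemma norm_fourier_apply (n : ℤ) (θ : UnitAddCircle) : ‖fourier n θ‖ = 1 :=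
  Circle.norm_coe _

lemma eq_of_klDiv_eq_zero {p q : ProbabilityMeasure UnitAddCircle}
    (h : klDiv (p : Measure UnitAddCircle) (q : Measure UnitAddCircle) = 0) : p = q := by
  have h' : (p : Measure UnitAddCircle) = q := klDiv_eq_zero_iff.1 h
  exact Subtype.ext h'

/-- The relative entropy with respect to the uniform distribution as a real number; it is `0` by
convention where the entropy is infinite. -/
def entropy (q : ProbabilityMeasure UnitAddCircle) : ℝ :=
  (klDiv (q : Measure UnitAddCircle) volume).toReal

/-- The relative entropy with respect to the uniform distribution is finite. -/
def FiniteEntropy (q : ProbabilityMeasure UnitAddCircle) : Prop :=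
  klDiv (q : Measure UnitAddCircle) volume ≠ ⊤

lemma entropy_nonneg (q : ProbabilityMeasure UnitAddCircle) : 0 ≤ entropy q :=
  ENNReal.toReal_nonneg

lemma entropy_uniform : entropy uniform = 0 := by simp [entropy, uniform]

lemma finiteEntropy_uniform : FiniteEntropy uniform := by simp [FiniteEntropy, uniform]

lemma eq_uniform_of_entropy_le_zero {q : ProbabilityMeasure UnitAddCircle}
    (hq : FiniteEntropy q) (h : entropy q ≤ 0) : q = uniform := by
  have h0 : klDiv (q : Measure UnitAddCircle) volume = 0 :=
    ((ENNReal.toReal_eq_zero_iff _).1 (le_antisymm h (entropy_nonneg q))).resolve_right hq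
  exact eq_of_klDiv_eq_zero h0

/-! ### Gibbs measures and the variational principle -/

/-- The Gibbs measure with density proportional to `exp f`. -/
def gibbs (f : C(UnitAddCircle, ℝ)) : ProbabilityMeasure UnitAddCircle :=
  ⟨(volume : Measure UnitAddCircle).tilted f,
    isProbabilityMeasure_tilted (integrable_of_continuous (by fun_prop))⟩

/-- The logarithm of the partition function `∫ exp f`. -/
def logPartition (f : C(UnitAddCircle, ℝ)) : ℝ :=
  Real.log (∫ θ, Real.exp (f θ))

lemma klDiv_gibbs_ne_top {q : ProbabilityMeasure UnitAddCircle} (hq : FiniteEntropy q)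
    (f : C(UnitAddCircle, ℝ)) :
    klDiv (q : Measure UnitAddCircle) (gibbs f : Measure UnitAddCircle) ≠ ⊤ := by
  obtain ⟨hac, hint⟩ := klDiv_ne_top_iff.1 hq
  have he : Integrable (fun θ => Real.exp (f θ)) (volume : Measure UnitAddCircle) :=
    integrable_of_continuous (by fun_prop)
  exact klDiv_ne_top (hac.trans (absolutelyContinuous_tilted he))
    (integrable_llr_tilted_right hac (integrable_of_continuous f.continuous) hint he)

/-- The Gibbs variational identity. -/
lemma entropy_eq {q : ProbabilityMeasure UnitAddCircle} (hq : FiniteEntropy q)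
    (f : C(UnitAddCircle, ℝ)) :
    entropy q = (klDiv (q : Measure UnitAddCircle) (gibbs f : Measure UnitAddCircle)).toReal +
      ∫ θ, f θ ∂(q : Measure UnitAddCircle) - logPartition f := by
  obtain ⟨hac, hint⟩ := klDiv_ne_top_iff.1 hq
  have he : Integrable (fun θ => Real.exp (f θ)) (volume : Measure UnitAddCircle) :=
    integrable_of_continuous (by fun_prop)
  have hg : (gibbs f : Measure UnitAddCircle) = volume.tilted f := rfl
  rw [entropy, toReal_klDiv_of_measure_eq hac (by simp),
    toReal_klDiv_of_measure_eq (ν := (gibbs f : Measure UnitAddCircle)) (hac.trans (absolutelyContinuous_tilted he)) (by simp)]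
  have := integral_llr_tilted_right hac (integrable_of_continuous f.continuous) he hint
  rw [logPartition, hg, this]
  ring

lemma integral_sub_logPartition_le_entropy {q : ProbabilityMeasure UnitAddCircle}
    (hq : FiniteEntropy q) (f : C(UnitAddCircle, ℝ)) :
    ∫ θ, f θ ∂(q : Measure UnitAddCircle) - logPartition f ≤ entropy q := by
  have := entropy_eq hq f
  have h0 : 0 ≤ (klDiv (q : Measure UnitAddCircle) (gibbs f : Measure UnitAddCircle)).toReal :=
    ENNReal.toReal_nonneg
  linarith

lemma finiteEntropy_gibbs (f : C(UnitAddCircle, ℝ)) : FiniteEntropy (gibbs f) := by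
  have he : Integrable (fun θ => Real.exp (f θ)) (volume : Measure UnitAddCircle) :=
    integrable_of_continuous (by fun_prop)
  have hp : IsProbabilityMeasure ((volume : Measure UnitAddCircle).tilted f) := (gibbs f).2
  refine klDiv_ne_top (tilted_absolutelyContinuous _ _) ?_
  change Integrable (llr (volume.tilted f) volume) (volume.tilted f)
  have h2 : llr (volume.tilted f) volume =ᵐ[volume.tilted f]
      fun θ => f θ - Real.log (∫ z : UnitAddCircle, Real.exp (f z)) :=
    (tilted_absolutelyContinuous _ _).ae_le
      (log_rnDeriv_tilted_left_self he)
  rw [integrable_congr h2]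
  exact integrable_of_continuous (by fun_prop)

/-! ### The dual functional -/

/-- The Fourier coefficient `∫ exp (2 π i (k + 1) θ) dq(θ)`: the index `k` stands for the
frequency `k + 1`. -/
def mode (q : ProbabilityMeasure UnitAddCircle) (k : ℕ) : ℂ :=
  ∫ θ, fourier ((k : ℤ) + 1) θ ∂(q : Measure UnitAddCircle)

lemma norm_mode_le_one (q : ProbabilityMeasure UnitAddCircle) (k : ℕ) : ‖mode q k‖ ≤ 1 := by
  have := norm_integral_le_of_norm_le_const (μ := (q : Measure UnitAddCircle)) (C := 1)
    (f := fun θ => fourier ((k : ℤ) + 1) θ) (ae_of_all _ fun θ => (norm_fourier_apply _ θ).le)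
  rwa [probReal_univ, mul_one] at this

lemma integral_fourier_volume (n : ℤ) :
    ∫ θ : UnitAddCircle, fourier n θ = if n = 0 then 1 else 0 := by
  have h := congr_fun (fourierCoeff_fourier (T := 1) n) 0
  rw [fourierCoeff] at h
  rw [AddCircle.integral_haarAddCircle] at h
  simp only [neg_zero, fourier_zero, one_smul, inv_one, Pi.single_apply] at h
  simpa [eq_comm] using h

lemma mode_uniform (k : ℕ) : mode uniform k = 0 := by
  have := integral_fourier_volume ((k : ℤ) + 1)
  rwa [if_neg (by omega)] at this

/-- The quadratic form `2 ∑ w_k |p_k| ^ 2` on sequences of Fourier coefficients. -/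
def quad (w : ℕ → ℝ) (p : ℕ → ℂ) : ℝ := 2 * ∑' k, w k * ‖p k‖ ^ 2

/-- The contribution of one frequency to `potential`. -/
def potentialTerm (w : ℕ → ℝ) (p : ℕ → ℂ) (k : ℕ) : C(UnitAddCircle, ℝ) where
  toFun θ := 4 * w k * (conj (p k) * fourier ((k : ℤ) + 1) θ).re
  continuous_toFun := by fun_prop

/-- The potential `4 ∑ w_k Re (conj p_k exp (2 π i (k + 1) θ))`; if `p` are the Fourier
coefficients of `q` and `w` those of a kernel `W` of mean zero, this is `2 W * q`. -/
def potential (w : ℕ → ℝ) (p : ℕ → ℂ) : C(UnitAddCircle, ℝ) := ∑' k, potentialTerm w p k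

/-- The functional dual to the free energy. Its variable is a sequence of Fourier coefficients. -/
def dual (w : ℕ → ℝ) (K : ℝ) (p : ℕ → ℂ) : ℝ :=
  K * quad w p - logPartition (K • potential w p)

/-- The free energy without the contribution of the mean of the kernel. -/
def reducedEnergy (w : ℕ → ℝ) (K : ℝ) (q : ProbabilityMeasure UnitAddCircle) : ℝ :=
  entropy q - K * quad w (mode q)

/-- The even kernel `W` has mean `c` and the positive summable Fourier coefficients `w k` at the
frequencies `k + 1`, the first of which is the largest. -/
structure HasPositiveModes (W : C(UnitAddCircle, ℝ)) (c : ℝ) (w : ℕ → ℝ) : Prop where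
  pos : ∀ k, 0 < w k
  le_first : ∀ k, w k ≤ w 0
  summable : Summable w
  hasSum : ∀ θ, HasSum (fun k : ℕ => 2 * w k * (fourier ((k : ℤ) + 1) θ).re) (W θ - c)

section

variable {W : C(UnitAddCircle, ℝ)} {c : ℝ} {w : ℕ → ℝ}

lemma HasPositiveModes.summable_quad (h : HasPositiveModes W c w) {p : ℕ → ℂ} {C : ℝ}
    (hp : ∀ k, ‖p k‖ ≤ C) : Summable fun k => w k * ‖p k‖ ^ 2 := by
  refine Summable.of_nonneg_of_le (fun k => ?_) (fun k => ?_) (h.summable.mul_right (C ^ 2))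
  · have := (h.pos k).le; positivity
  · have := hp k
    have := (h.pos k).le
    gcongr

lemma HasPositiveModes.quad_nonneg (h : HasPositiveModes W c w) (p : ℕ → ℂ) : 0 ≤ quad w p :=
  mul_nonneg zero_le_two (tsum_nonneg fun k => mul_nonneg (h.pos k).le (sq_nonneg _))

lemma norm_potentialTerm_le (h : HasPositiveModes W c w) {p : ℕ → ℂ} (k : ℕ)
    (θ : UnitAddCircle) : ‖potentialTerm w p k θ‖ ≤ 4 * w k * ‖p k‖ := by
  have hw := (h.pos k).le
  change ‖4 * w k * (conj (p k) * fourier ((k : ℤ) + 1) θ).re‖ ≤ _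
  rw [norm_mul, Real.norm_of_nonneg (by positivity)]
  gcongr
  refine (Complex.abs_re_le_norm _).trans ?_
  rw [norm_mul, norm_fourier_apply, RCLike.norm_conj, mul_one]

lemma summable_potentialTerm (h : HasPositiveModes W c w) {p : ℕ → ℂ} (hp : ∀ k, ‖p k‖ ≤ 1) :
    Summable (potentialTerm w p) := by
  refine Summable.of_norm_bounded (h.summable.mul_left 4) fun k => ?_
  have hw := (h.pos k).le
  refine (ContinuousMap.norm_le _ (by positivity)).2 fun θ => ?_
  exact (norm_potentialTerm_le h k θ).trans (mul_le_of_le_one_right (by positivity) (hp k))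

lemma potential_apply (h : HasPositiveModes W c w) {p : ℕ → ℂ} (hp : ∀ k, ‖p k‖ ≤ 1)
    (θ : UnitAddCircle) : potential w p θ = ∑' k, potentialTerm w p k θ :=
  (ContinuousMap.tsum_apply (summable_potentialTerm h hp) θ).symm

lemma summable_norm_mode (h : HasPositiveModes W c w) {p : ℕ → ℂ} (hp : ∀ k, ‖p k‖ ≤ 1) :
    Summable fun k => w k * ‖p k‖ := by
  refine Summable.of_nonneg_of_le (fun k => ?_) (fun k => ?_) h.summable
  · have := (h.pos k).le; positivity
  · exact mul_le_of_le_one_right (h.pos k).le (hp k)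

lemma abs_potential_le (h : HasPositiveModes W c w) {p : ℕ → ℂ} (hp : ∀ k, ‖p k‖ ≤ 1)
    (θ : UnitAddCircle) : |potential w p θ| ≤ 4 * ∑' k, w k * ‖p k‖ := by
  rw [potential_apply h hp, ← tsum_mul_left, ← Real.norm_eq_abs]
  have hs : Summable fun k => 4 * (w k * ‖p k‖) := (summable_norm_mode h hp).mul_left 4
  exact tsum_of_norm_bounded hs.hasSum fun k =>
    (norm_potentialTerm_le h k θ).trans_eq (mul_assoc _ _ _)

lemma integral_re_fourier_mul (μ : Measure UnitAddCircle) [IsFiniteMeasure μ] (a : ℂ) (n : ℤ)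
    {g : UnitAddCircle → ℝ} (hg : Continuous g) :
    ∫ θ, (a * fourier n θ).re * g θ ∂μ = (a * ∫ θ, fourier n θ * g θ ∂μ).re := by
  have hi : Integrable (fun θ => fourier n θ * (g θ : ℂ)) μ :=
    integrable_of_continuous (by fun_prop)
  rw [← integral_const_mul]
  change _ = Complex.reCLM _
  rw [← ContinuousLinearMap.integral_comp_comm _ (hi.const_mul a)]
  refine integral_congr_ae (ae_of_all _ fun θ => ?_)
  simp [← mul_assoc]

/-- The integral of the potential against a measure with a continuous weight `g`. -/
lemma hasSum_integral_potential (h : HasPositiveModes W c w) {p : ℕ → ℂ} (hp : ∀ k, ‖p k‖ ≤ 1)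
    (μ : Measure UnitAddCircle) [IsFiniteMeasure μ] (g : C(UnitAddCircle, ℝ)) :
    HasSum (fun k => 4 * w k *
      (conj (p k) * ∫ θ, fourier ((k : ℤ) + 1) θ * g θ ∂μ).re)
      (∫ θ, potential w p θ * g θ ∂μ) := by
  have key := hasSum_integral_of_norm_le μ (F := fun k θ => potentialTerm w p k θ * g θ)
    (u := fun k => 4 * w k * ‖g‖) (fun k => by fun_prop)
    ((h.summable.mul_left 4).mul_right _) (fun k θ => by
      rw [norm_mul]
      have hw := (h.pos k).le
      have h1 := (norm_potentialTerm_le h (p := p) k θ).trans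
        (mul_le_of_le_one_right (by positivity) (hp k))
      have h2 := g.norm_coe_le_norm θ
      gcongr)
  have e1 : ∀ k, ∫ θ, potentialTerm w p k θ * g θ ∂μ = 4 * w k *
      (conj (p k) * ∫ θ, fourier ((k : ℤ) + 1) θ * g θ ∂μ).re := by
    intro k
    rw [← integral_re_fourier_mul μ _ _ g.continuous, ← integral_const_mul]
    refine integral_congr_ae (ae_of_all _ fun θ => ?_)
    simp only [potentialTerm, ContinuousMap.coe_mk, mul_assoc]
  have e2 : ∀ θ, ∑' k, potentialTerm w p k θ * g θ = potential w p θ * g θ := fun θ => by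
    rw [tsum_mul_right, potential_apply h hp]
  simpa only [e1, e2] using key

lemma integral_potential (h : HasPositiveModes W c w) {p : ℕ → ℂ} (hp : ∀ k, ‖p k‖ ≤ 1)
    (q : ProbabilityMeasure UnitAddCircle) :
    ∫ θ, potential w p θ ∂(q : Measure UnitAddCircle) =
      quad w p + quad w (mode q) - quad w (fun k => p k - mode q k) := by
  have key := hasSum_integral_potential h hp (q : Measure UnitAddCircle) 1
  simp only [ContinuousMap.one_apply, mul_one, Complex.ofReal_one] at key
  have s1 := h.summable_quad hp
  have s2 := h.summable_quad (norm_mode_le_one q)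
  have s3 : Summable fun k => w k * ‖p k - mode q k‖ ^ 2 :=
    h.summable_quad (C := 2) fun k => (norm_sub_le _ _).trans (by
      linarith [hp k, norm_mode_le_one q k])
  rw [← key.tsum_eq, quad, quad, quad, ← mul_add, ← mul_sub, ← s1.tsum_add s2,
    ← (s1.add s2).tsum_sub s3, ← tsum_mul_left]
  refine tsum_congr fun k => ?_
  change 4 * w k * (conj (p k) * mode q k).re = _
  rw [← Complex.normSq_eq_norm_sq, ← Complex.normSq_eq_norm_sq, ← Complex.normSq_eq_norm_sq]
  simp only [Complex.normSq_apply, Complex.mul_re, Complex.conj_re, Complex.conj_im,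
    Complex.sub_re, Complex.sub_im]
  ring

/-- The identity behind the duality: the free energy of `q` and the dual functional at `p` differ
by a relative entropy and a positive definite quadratic form. -/
lemma reducedEnergy_eq (h : HasPositiveModes W c w) (K : ℝ) {p : ℕ → ℂ} (hp : ∀ k, ‖p k‖ ≤ 1)
    {q : ProbabilityMeasure UnitAddCircle} (hq : FiniteEntropy q) :
    reducedEnergy w K q =
      (klDiv (q : Measure UnitAddCircle)
        (gibbs (K • potential w p) : Measure UnitAddCircle)).toReal +
      dual w K p - K * quad w (fun k => p k - mode q k) := by
  have h1 := entropy_eq hq (K • potential w p)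
  have h2 : ∫ θ, (K • potential w p) θ ∂(q : Measure UnitAddCircle) =
      K * (quad w p + quad w (mode q) - quad w (fun k => p k - mode q k)) := by
    rw [← integral_potential h hp q, ← integral_const_mul]
    rfl
  rw [reducedEnergy, dual, h1, h2]
  ring

lemma reducedEnergy_gibbs (h : HasPositiveModes W c w) (K : ℝ) {p : ℕ → ℂ}
    (hp : ∀ k, ‖p k‖ ≤ 1) :
    reducedEnergy w K (gibbs (K • potential w p)) =
      dual w K p - K * quad w (fun k => p k - mode (gibbs (K • potential w p)) k) := by
  rw [reducedEnergy_eq h K hp (finiteEntropy_gibbs _), klDiv_self]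
  simp

lemma reducedEnergy_gibbs_le (h : HasPositiveModes W c w) {K : ℝ} (hK : 0 ≤ K) {p : ℕ → ℂ}
    (hp : ∀ k, ‖p k‖ ≤ 1) : reducedEnergy w K (gibbs (K • potential w p)) ≤ dual w K p := by
  rw [reducedEnergy_gibbs h K hp]
  have := mul_nonneg hK (h.quad_nonneg fun k => p k - mode (gibbs (K • potential w p)) k)
  linarith

lemma reducedEnergy_eq_dual_mode (h : HasPositiveModes W c w) (K : ℝ)
    {q : ProbabilityMeasure UnitAddCircle} (hq : FiniteEntropy q) :
    reducedEnergy w K q =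
      (klDiv (q : Measure UnitAddCircle)
        (gibbs (K • potential w (mode q)) : Measure UnitAddCircle)).toReal +
      dual w K (mode q) := by
  rw [reducedEnergy_eq h K (norm_mode_le_one q) hq]
  simp [quad]

lemma dual_mode_le (h : HasPositiveModes W c w) (K : ℝ)
    {q : ProbabilityMeasure UnitAddCircle} (hq : FiniteEntropy q) :
    dual w K (mode q) ≤ reducedEnergy w K q := by
  rw [reducedEnergy_eq_dual_mode h K hq]
  linarith [(ENNReal.toReal_nonneg : 0 ≤ (klDiv (q : Measure UnitAddCircle)
        (gibbs (K • potential w (mode q)) : Measure UnitAddCircle)).toReal)]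

lemma reducedEnergy_uniform (w : ℕ → ℝ) (K : ℝ) : reducedEnergy w K uniform = 0 := by
  simp [reducedEnergy, entropy_uniform, quad, mode_uniform]

/-! ### Global minimizers -/

lemma interactionEnergy_eq (h : HasPositiveModes W c w)
    (q : ProbabilityMeasure UnitAddCircle) :
    interactionEnergy W q = c + quad w (mode q) := by
  have hW : ∀ θ θ' : UnitAddCircle, W (θ - θ') = c + ∑' k : ℕ,
      2 * w k * (conj (fourier ((k : ℤ) + 1) θ') * fourier ((k : ℤ) + 1) θ).re := by
    intro θ θ'
    rw [← sub_eq_iff_eq_add', ← (h.hasSum (θ - θ')).tsum_eq]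
    refine tsum_congr fun k => ?_
    congr 2
    rw [fourier_apply, fourier_apply, fourier_apply, smul_sub, sub_eq_add_neg,
      AddCircle.toCircle_add, AddCircle.toCircle_neg, Circle.coe_mul, Circle.coe_inv_eq_conj,
      mul_comm]
  have hb : ∀ (k : ℕ) (a : ℂ) (θ : UnitAddCircle), ‖a‖ ≤ 1 →
      ‖2 * w k * (a * fourier ((k : ℤ) + 1) θ).re‖ ≤ 2 * w k := by
    intro k a θ ha
    have hw := (h.pos k).le
    rw [norm_mul, Real.norm_of_nonneg (by positivity)]
    refine mul_le_of_le_one_right (by positivity) ((Complex.abs_re_le_norm _).trans ?_)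
    rwa [norm_mul, norm_fourier_apply, mul_one]
  have hre : ∀ (k : ℕ) (a : ℂ), ∫ θ, 2 * w k * (a * fourier ((k : ℤ) + 1) θ).re
      ∂(q : Measure UnitAddCircle) = 2 * w k * (a * mode q k).re := by
    intro k a
    have := integral_re_fourier_mul (q : Measure UnitAddCircle) a ((k : ℤ) + 1)
      (g := fun _ => 1) continuous_const
    simp only [mul_one, Complex.ofReal_one] at this
    rw [integral_const_mul, this]
    rfl
  have inner : ∀ θ : UnitAddCircle, ∫ θ', W (θ - θ') ∂(q : Measure UnitAddCircle) =
      c + ∑' k : ℕ, 2 * w k * (conj (mode q k) * fourier ((k : ℤ) + 1) θ).re := by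
    intro θ
    simp only [hW]
    have hsym : ∀ a b : ℂ, (conj b * a).re = (conj a * b).re := by
      intro a b
      simp only [Complex.mul_re, Complex.conj_re, Complex.conj_im]; ring
    have key := hasSum_integral_of_norm_le (q : Measure UnitAddCircle)
      (F := fun (k : ℕ) θ' =>
        2 * w k * (conj (fourier ((k : ℤ) + 1) θ) * fourier ((k : ℤ) + 1) θ').re)
      (fun k => by fun_prop) (h.summable.mul_left 2)
      (fun k θ' => hb k _ θ' (by rw [RCLike.norm_conj, norm_fourier_apply]))
    have hcont : Continuous fun θ' => ∑' k : ℕ,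
        2 * w k * (conj (fourier ((k : ℤ) + 1) θ) * fourier ((k : ℤ) + 1) θ').re :=
      continuous_tsum (fun k => by fun_prop) (h.summable.mul_left 2)
        (fun k θ' => hb k _ θ' (by rw [RCLike.norm_conj, norm_fourier_apply]))
    have e : ∀ θ' : UnitAddCircle, (∑' k : ℕ,
        2 * w k * (conj (fourier ((k : ℤ) + 1) θ') * fourier ((k : ℤ) + 1) θ).re) = ∑' k : ℕ,
        2 * w k * (conj (fourier ((k : ℤ) + 1) θ) * fourier ((k : ℤ) + 1) θ').re :=
      fun θ' => tsum_congr fun k => by rw [hsym]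
    simp only [e, hsym (fourier _ θ) (mode q _)]
    rw [integral_add (integrable_const _) (integrable_of_continuous hcont), ← key.tsum_eq]
    simp only [hre, integral_const, probReal_univ, one_smul]
  rw [interactionEnergy]
  simp only [inner]
  have key := hasSum_integral_of_norm_le (q : Measure UnitAddCircle)
    (F := fun (k : ℕ) θ => 2 * w k * (conj (mode q k) * fourier ((k : ℤ) + 1) θ).re)
    (fun k => by fun_prop) (h.summable.mul_left 2)
    (fun k θ => hb k _ θ (by rw [RCLike.norm_conj]; exact norm_mode_le_one q k))
  have hcont : Continuous fun θ => ∑' k : ℕ,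
      2 * w k * (conj (mode q k) * fourier ((k : ℤ) + 1) θ).re :=
    continuous_tsum (fun k => by fun_prop) (h.summable.mul_left 2)
      (fun k θ => hb k _ θ (by rw [RCLike.norm_conj]; exact norm_mode_le_one q k))
  rw [integral_add (integrable_const _) (integrable_of_continuous hcont), ← key.tsum_eq, quad,
    ← tsum_mul_left]
  simp only [hre, integral_const, probReal_univ, one_smul]
  congr 1
  refine tsum_congr fun k => ?_
  rw [mul_comm (conj _), Complex.mul_conj, Complex.ofReal_re, Complex.normSq_eq_norm_sq]
  ring

lemma freeEnergy_eq_coe (h : HasPositiveModes W c w) (K : ℝ)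
    {q : ProbabilityMeasure UnitAddCircle} (hq : FiniteEntropy q) :
    freeEnergy W K q = ((reducedEnergy w K q - K * c : ℝ) : EReal) := by
  rw [freeEnergy, interactionEnergy_eq h, ← ENNReal.ofReal_toReal hq, EReal.coe_ennreal_ofReal,
    max_eq_left ENNReal.toReal_nonneg, ← EReal.coe_sub, reducedEnergy, entropy]
  congr 1
  ring

lemma freeEnergy_eq_top (W : C(UnitAddCircle, ℝ)) (K : ℝ)
    {q : ProbabilityMeasure UnitAddCircle} (hq : ¬ FiniteEntropy q) : freeEnergy W K q = ⊤ := by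
  rw [freeEnergy, not_not.1 hq, EReal.coe_ennreal_top, EReal.top_sub_coe]

lemma isGlobalMinimizer_iff (h : HasPositiveModes W c w) (K : ℝ)
    (q : ProbabilityMeasure UnitAddCircle) :
    IsGlobalMinimizer W K q ↔ FiniteEntropy q ∧
      ∀ p, FiniteEntropy p → reducedEnergy w K q ≤ reducedEnergy w K p := by
  constructor
  · intro hq
    have hfin : FiniteEntropy q := by
      by_contra hinf
      have := hq uniform
      rw [freeEnergy_eq_top W K hinf, freeEnergy_eq_coe h K finiteEntropy_uniform, top_le_iff]
        at this
      exact EReal.coe_ne_top _ this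
    refine ⟨hfin, fun p hp => ?_⟩
    have := hq p
    rw [freeEnergy_eq_coe h K hfin, freeEnergy_eq_coe h K hp, EReal.coe_le_coe_iff] at this
    linarith
  · rintro ⟨hfin, hq⟩ p
    by_cases hp : FiniteEntropy p
    · rw [freeEnergy_eq_coe h K hfin, freeEnergy_eq_coe h K hp, EReal.coe_le_coe_iff]
      linarith [hq p hp]
    · rw [freeEnergy_eq_top W K hp]
      exact le_top

lemma isGlobalMinimizer_uniform_iff (h : HasPositiveModes W c w) (K : ℝ) :
    IsGlobalMinimizer W K uniform ↔ ∀ q, FiniteEntropy q → 0 ≤ reducedEnergy w K q := by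
  rw [isGlobalMinimizer_iff h, reducedEnergy_uniform]
  exact and_iff_right finiteEntropy_uniform

lemma IsGlobalMinimizer.reducedEnergy_nonpos (h : HasPositiveModes W c w) {K : ℝ}
    {q : ProbabilityMeasure UnitAddCircle} (hq : IsGlobalMinimizer W K q) :
    reducedEnergy w K q ≤ 0 := by
  have := ((isGlobalMinimizer_iff h K q).1 hq).2 uniform finiteEntropy_uniform
  rwa [reducedEnergy_uniform] at this

/-- The self-consistency (Euler-Lagrange) equation of a global minimizer. -/
lemma IsGlobalMinimizer.eq_gibbs (h : HasPositiveModes W c w) {K : ℝ} (hK : 0 ≤ K)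
    {q : ProbabilityMeasure UnitAddCircle} (hq : IsGlobalMinimizer W K q) :
    q = gibbs (K • potential w (mode q)) := by
  obtain ⟨hfin, hmin⟩ := (isGlobalMinimizer_iff h K q).1 hq
  have h1 := hmin _ (finiteEntropy_gibbs (K • potential w (mode q)))
  have h2 := reducedEnergy_gibbs_le h hK (norm_mode_le_one q)
  have h3 := reducedEnergy_eq_dual_mode h K hfin
  have h4 : (klDiv (q : Measure UnitAddCircle)
        (gibbs (K • potential w (mode q)) : Measure UnitAddCircle)).toReal = 0 :=
    le_antisymm (by linarith) ENNReal.toReal_nonneg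
  have h5 := ((ENNReal.toReal_eq_zero_iff _).1 h4).resolve_right (klDiv_gibbs_ne_top hfin _)
  exact eq_of_klDiv_eq_zero h5

end

section

variable {W : C(UnitAddCircle, ℝ)} {c : ℝ} {w : ℕ → ℝ}

/-! ### Existence of minimizers -/

lemma norm_coe_le_one (p : ℕ → Metric.closedBall (0 : ℂ) 1) (k : ℕ) : ‖(p k : ℂ)‖ ≤ 1 :=
  mem_closedBall_zero_iff.1 (p k).2

lemma continuous_quad (h : HasPositiveModes W c w) :
    Continuous fun p : ℕ → Metric.closedBall (0 : ℂ) 1 => quad w fun k => p k := by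
  refine continuous_const.mul (continuous_tsum (fun k => by fun_prop) h.summable fun k p => ?_)
  rw [norm_mul, Real.norm_of_nonneg (h.pos k).le, norm_pow, norm_norm]
  exact mul_le_of_le_one_right (h.pos k).le (pow_le_one₀ (norm_nonneg _) (norm_coe_le_one p k))

lemma continuous_potential (h : HasPositiveModes W c w) :
    Continuous fun x : (ℕ → Metric.closedBall (0 : ℂ) 1) × UnitAddCircle =>
      potential w (fun k => x.1 k) x.2 := by
  simp only [potential_apply h (norm_coe_le_one _)]
  refine continuous_tsum (fun k => ?_) (h.summable.mul_left 4) fun k x => ?_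
  · simp only [potentialTerm, ContinuousMap.coe_mk]
    fun_prop
  · have hw := (h.pos k).le
    exact (norm_potentialTerm_le h k x.2).trans
      (mul_le_of_le_one_right (by positivity) (norm_coe_le_one x.1 k))

lemma partition_pos (f : C(UnitAddCircle, ℝ)) :
    0 < ∫ θ : UnitAddCircle, Real.exp (f θ) :=
  integral_exp_pos (integrable_of_continuous (Real.continuous_exp.comp f.continuous))

lemma continuous_dual (h : HasPositiveModes W c w) :
    Continuous fun x : ℝ × (ℕ → Metric.closedBall (0 : ℂ) 1) => dual w x.1 fun k => x.2 k := by
  have hc : Continuous fun x : ℝ × (ℕ → Metric.closedBall (0 : ℂ) 1) =>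
      ∫ θ in Set.univ, Real.exp (x.1 * potential w (fun k => x.2 k) θ) := by
    refine continuous_parametric_integral_of_continuous ?_ isCompact_univ
    have := continuous_potential h
    have h2 : Continuous fun x : (ℝ × (ℕ → Metric.closedBall (0 : ℂ) 1)) × UnitAddCircle =>
        potential w (fun k => x.1.2 k) x.2 :=
      this.comp (f := fun x : (ℝ × (ℕ → Metric.closedBall (0 : ℂ) 1)) × UnitAddCircle =>
        (x.1.2, x.2)) (by fun_prop)
    change Continuous fun x : (ℝ × (ℕ → Metric.closedBall (0 : ℂ) 1)) × UnitAddCircle =>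
      Real.exp (x.1.1 * potential w (fun k => x.1.2 k) x.2)
    fun_prop
  simp only [Measure.restrict_univ] at hc
  refine (continuous_fst.mul ((continuous_quad h).comp continuous_snd)).sub (hc.log fun x => ?_)
  exact (partition_pos (x.1 • potential w fun k => x.2 k)).ne'

lemma exists_isGlobalMinimizer (h : HasPositiveModes W c w) {K : ℝ} (hK : 0 ≤ K) :
    ∃ q, IsGlobalMinimizer W K q := by
  have hcont : Continuous fun p : ℕ → Metric.closedBall (0 : ℂ) 1 => dual w K fun k => p k :=
    (continuous_dual h).comp (Continuous.prodMk_right K)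
  have hne : Nonempty (Metric.closedBall (0 : ℂ) 1) := ⟨⟨0, by simp⟩⟩
  obtain ⟨p, -, hp⟩ := isCompact_univ.exists_isMinOn Set.univ_nonempty hcont.continuousOn
  refine ⟨gibbs (K • potential w fun k => p k), (isGlobalMinimizer_iff h K _).2
    ⟨finiteEntropy_gibbs _, fun q hq => ?_⟩⟩
  calc _ ≤ dual w K fun k => p k := reducedEnergy_gibbs_le h hK (norm_coe_le_one p)
    _ ≤ dual w K (mode q) := isMinOn_iff.1 hp
        (fun k => ⟨mode q k, mem_closedBall_zero_iff.2 (norm_mode_le_one q k)⟩) (Set.mem_univ _)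
    _ ≤ _ := dual_mode_le h K hq

/-! ### Stability of the uniform distribution below the linear threshold -/

lemma integral_fourier_mul_re (j k : ℕ) (a : ℂ) :
    ∫ θ : UnitAddCircle, fourier ((j : ℤ) + 1) θ * ((a * fourier ((k : ℤ) + 1) θ).re : ℂ) =
      if j = k then conj a / 2 else 0 := by
  have e : ∀ θ : UnitAddCircle,
      fourier ((j : ℤ) + 1) θ * ((a * fourier ((k : ℤ) + 1) θ).re : ℂ) =
        a / 2 * fourier ((j : ℤ) + 1 + (k + 1)) θ +
          conj a / 2 * fourier ((j : ℤ) + 1 + -(k + 1)) θ := by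
    intro θ
    rw [Complex.re_eq_add_conj, map_mul, fourier_add (m := (j : ℤ) + 1),
      fourier_add (m := (j : ℤ) + 1), fourier_neg]
    ring
  simp only [e]
  rw [integral_add (integrable_of_continuous (by fun_prop))
    (integrable_of_continuous (by fun_prop)), integral_const_mul, integral_const_mul,
    integral_fourier_volume, integral_fourier_volume, if_neg (by omega)]
  by_cases hjk : j = k
  · rw [if_pos (by omega), if_pos hjk]; ring
  · rw [if_neg (by omega), if_neg hjk]; ring

lemma integral_potential_sq_le (h : HasPositiveModes W c w) {p : ℕ → ℂ} (hp : ∀ k, ‖p k‖ ≤ 1) :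
    ∫ θ : UnitAddCircle, potential w p θ ^ 2 ≤ 4 * w 0 * quad w p := by
  have inner : ∀ k : ℕ, (conj (p k) * ∫ θ : UnitAddCircle,
      fourier ((k : ℤ) + 1) θ * (potential w p θ : ℂ)).re = 2 * w k * ‖p k‖ ^ 2 := by
    intro k
    obtain ⟨g, hg⟩ : ∃ g : C(UnitAddCircle, ℝ),
        ∀ θ, g θ = (conj (p k) * fourier ((k : ℤ) + 1) θ).re :=
      ⟨⟨fun θ => (conj (p k) * fourier ((k : ℤ) + 1) θ).re, by fun_prop⟩, fun _ => rfl⟩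
    have h1 := hasSum_integral_potential h hp volume g
    rw [← integral_re_fourier_mul volume _ _ (potential w p).continuous]
    have h2 : ∫ θ : UnitAddCircle, (conj (p k) * fourier ((k : ℤ) + 1) θ).re * potential w p θ =
        ∫ θ : UnitAddCircle, potential w p θ * g θ :=
      integral_congr_ae (ae_of_all _ fun θ => by simp only [hg, mul_comm])
    rw [h2]
    refine h1.unique ?_
    simp only [hg, integral_fourier_mul_re]
    convert hasSum_ite_eq k (2 * w k * ‖p k‖ ^ 2) using 1
    funext j
    split_ifs with hjk
    · subst hjk
      rw [Complex.conj_conj, ← mul_div_assoc, mul_comm (conj _), Complex.mul_conj,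
        Complex.normSq_eq_norm_sq, ← Complex.ofReal_ofNat, ← Complex.ofReal_div,
        Complex.ofReal_re]
      ring
    · simp
  have key := hasSum_integral_potential h hp volume (potential w p)
  simp only [inner] at key
  have hs := (h.summable_quad hp).hasSum.mul_left (8 * w 0)
  have : ∫ θ : UnitAddCircle, potential w p θ * potential w p θ ≤
      8 * w 0 * ∑' k, w k * ‖p k‖ ^ 2 := by
    refine hasSum_le (fun k => ?_) key hs
    have h1 := h.le_first k
    have h2 : 0 ≤ w k * ‖p k‖ ^ 2 := mul_nonneg (h.pos k).le (sq_nonneg _)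
    nlinarith [mul_le_mul_of_nonneg_right h1 h2]
  simp only [sq, quad] at this ⊢
  linarith

/-- The coefficient of `x ^ 2` tends to `1 / 2` with `δ`; a larger constant would not reach the
linear stability threshold. -/
lemma exp_le_quadratic {x δ : ℝ} (hδ : δ ≤ 1) (hx : |x| ≤ δ) :
    Real.exp x ≤ 1 + x + (1 + δ) / 2 * x ^ 2 := by
  have h := (abs_le.1 (Real.exp_bound (hx.trans hδ) (n := 3) (by norm_num))).2
  norm_num [Finset.sum_range_succ, Nat.factorial] at h
  have h3 : |x| ^ 3 ≤ δ * x ^ 2 := by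
    rw [pow_succ', sq_abs]
    gcongr
  have : 0 ≤ |x| ^ 3 := by positivity
  linarith

/-- A lower bound of the entropy by the quadratic form that is sharp to second order at the
uniform distribution. It comes from the Gibbs variational principle with the potential generated
by `q` itself. -/
lemma quad_le_entropy_of_small (h : HasPositiveModes W c w) {K δ : ℝ}
    (hδ : δ ≤ 1) {q : ProbabilityMeasure UnitAddCircle} (hq : FiniteEntropy q)
    (hsmall : ∀ θ, |K * potential w (mode q) θ| ≤ δ) :
    K * quad w (mode q) * (2 - (1 + δ) * (2 * K * w 0)) ≤ entropy q := by
  have hp := norm_mode_le_one q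
  have hδ0 : 0 ≤ δ := (abs_nonneg _).trans (hsmall 0)
  have h1 := integral_sub_logPartition_le_entropy hq (K • potential w (mode q))
  have h2 : ∫ θ, (K • potential w (mode q)) θ ∂(q : Measure UnitAddCircle) =
      K * (2 * quad w (mode q)) := by
    have := integral_potential h hp q
    have e : quad w (fun k => mode q k - mode q k) = 0 := by simp [quad]
    rw [e] at this
    change ∫ θ, K * potential w (mode q) θ ∂(q : Measure UnitAddCircle) = _
    rw [integral_const_mul, this]
    ring
  have h3 : ∫ θ : UnitAddCircle, potential w (mode q) θ = 0 := by
    have := integral_potential h hp uniform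
    simp only [mode_uniform, sub_zero] at this
    change ∫ θ : UnitAddCircle, potential w (mode q) θ = _ at this
    rw [this]
    simp [quad, mode_uniform]
  have h4 : logPartition (K • potential w (mode q)) ≤
      (1 + δ) / 2 * (K ^ 2 * (4 * w 0 * quad w (mode q))) := by
    refine (Real.log_le_sub_one_of_pos (partition_pos _)).trans ?_
    have hint : ∫ θ : UnitAddCircle, Real.exp ((K • potential w (mode q)) θ) ≤
        ∫ θ : UnitAddCircle, (1 + K * potential w (mode q) θ +
          (1 + δ) / 2 * (K ^ 2 * potential w (mode q) θ ^ 2)) := by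
      refine integral_mono (integrable_of_continuous (by fun_prop))
        (integrable_of_continuous (by fun_prop)) fun θ => ?_
      have := exp_le_quadratic hδ (hsmall θ)
      rwa [mul_pow] at this
    rw [integral_add (integrable_of_continuous (by fun_prop))
      (integrable_of_continuous (by fun_prop)), integral_add (integrable_const _)
      (integrable_of_continuous (by fun_prop)), integral_const_mul, integral_const_mul,
      integral_const_mul, h3] at hint
    simp only [integral_const, probReal_univ, one_smul, mul_zero, add_zero] at hint
    have := integral_potential_sq_le h hp
    have h5 : (1 + δ) / 2 * (K ^ 2 * ∫ θ : UnitAddCircle, potential w (mode q) θ ^ 2) ≤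
      (1 + δ) / 2 * (K ^ 2 * (4 * w 0 * quad w (mode q))) := by gcongr
    linarith
  rw [h2] at h1
  linarith

/-! ### The critical coupling -/

lemma exists_isCriticalCoupling (h : HasPositiveModes W c w) {K₀ : ℝ}
    (hunst : ¬ IsGlobalMinimizer W K₀ uniform) : ∃ Kc, IsCriticalCoupling W Kc := by
  set A : Set ℝ := {K | ∀ q, FiniteEntropy q → K * quad w (mode q) ≤ entropy q} with hA
  have hmem : ∀ K, K ∈ A ↔ IsGlobalMinimizer W K uniform := by
    intro K
    rw [isGlobalMinimizer_uniform_iff h]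
    simp only [hA, Set.mem_ofPred_eq, reducedEnergy, sub_nonneg]
  have hdown : ∀ K ∈ A, ∀ K' ≤ K, K' ∈ A := fun K hK K' hle q hq =>
    (mul_le_mul_of_nonneg_right hle (h.quad_nonneg _)).trans (hK q hq)
  have hbdd : BddAbove A := ⟨K₀, fun K hK => by
    by_contra hlt
    exact hunst ((hmem K₀).1 (hdown K hK K₀ (not_le.1 hlt).le))⟩
  set M : ℝ := ∑' k, w k with hM
  have hM0 : w 0 ≤ M := h.summable.le_tsum 0 fun k _ => (h.pos k).le
  have hMpos : 0 < M := (h.pos 0).trans_le hM0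
  -- at this coupling the potential is bounded by `1`, as `quad_le_entropy_of_small` requires
  have hsmall : 1 / (4 * M) ∈ A := by
    intro q hq
    have hp := norm_mode_le_one q
    have hb : ∀ θ, |1 / (4 * M) * potential w (mode q) θ| ≤ 1 := by
      intro θ
      have h1 := abs_potential_le h hp θ
      have h2 : ∑' k, w k * ‖mode q k‖ ≤ M := (summable_norm_mode h hp).tsum_le_tsum
        (fun k => mul_le_of_le_one_right (h.pos k).le (hp k)) h.summable
      rw [abs_mul, abs_of_nonneg (by positivity), one_div_mul_eq_div, div_le_one (by positivity)]
      linarith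
    have key := quad_le_entropy_of_small h le_rfl hq hb
    refine le_trans ?_ key
    have h3 : (1 + 1) * (2 * (1 / (4 * M)) * w 0) ≤ 1 := by
      rw [show (1 + 1) * (2 * (1 / (4 * M)) * w 0) = w 0 / M by field_simp; ring]
      exact (div_le_one hMpos).2 hM0
    have h4 : 0 ≤ 1 / (4 * M) * quad w (mode q) :=
      mul_nonneg (by positivity) (h.quad_nonneg _)
    exact le_mul_of_one_le_right h4 (by linarith)
  have hne : A.Nonempty := ⟨_, hsmall⟩
  have hpos : 0 < sSup A := lt_of_lt_of_le (by positivity) (le_csSup hbdd hsmall)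
  -- `A` is closed: for fixed `q` its condition on `K` is a non-strict linear inequality
  have hcrit : sSup A ∈ A := by
    intro q hq
    rcases (h.quad_nonneg (mode q)).eq_or_lt with h0 | h0
    · rw [← h0, mul_zero]
      exact entropy_nonneg q
    · rw [← le_div_iff₀ h0]
      exact csSup_le hne fun K hK => (le_div_iff₀ h0).2 (hK q hq)
  refine ⟨sSup A, hpos, fun K hK hlt q => ⟨fun hmin => ?_, ?_⟩, (hmem _).1 hcrit,
    fun K hK => ?_⟩
  · have hfin := ((isGlobalMinimizer_iff h K q).1 hmin).1
    have h1 := hmin.reducedEnergy_nonpos h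
    have h2 := hcrit q hfin
    rw [reducedEnergy] at h1
    refine eq_uniform_of_entropy_le_zero hfin ?_
    have h3 : quad w (mode q) ≤ 0 := by
      by_contra h0
      have := mul_lt_mul_of_pos_right hlt (not_le.1 h0)
      linarith
    have h4 := le_antisymm h3 (h.quad_nonneg _)
    rw [h4] at h1
    linarith
  · rintro rfl
    exact (hmem K).1 (hdown _ hcrit K hlt.le)
  · obtain ⟨q, hq⟩ := exists_isGlobalMinimizer h (hpos.trans hK).le
    refine ⟨q, ?_, hq⟩
    rintro rfl
    exact hK.not_ge (le_csSup hbdd ((hmem K).2 hq))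

/-! ### Continuous transitions -/

lemma l1DistUniform_gibbs_le {f : C(UnitAddCircle, ℝ)} {δ : ℝ} (hf : ∀ θ, |f θ| ≤ δ) :
    l1DistUniform (gibbs f) ≤ ENNReal.ofReal (Real.exp (2 * δ) - 1) := by
  set Z := ∫ θ : UnitAddCircle, Real.exp (f θ) with hZ
  have he : Integrable (fun θ => Real.exp (f θ)) (volume : Measure UnitAddCircle) :=
    integrable_of_continuous (by fun_prop)
  have hZ0 : 0 < Z := partition_pos f
  have hZ1 : Z ≤ Real.exp δ := by
    have := integral_mono he (integrable_const (Real.exp δ))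
      fun θ => Real.exp_le_exp.2 (abs_le.1 (hf θ)).2
    simpa using this
  have hZ2 : Real.exp (-δ) ≤ Z := by
    have := integral_mono (integrable_const (Real.exp (-δ))) he
      fun θ => Real.exp_le_exp.2 (abs_le.1 (hf θ)).1
    simpa using this
  have hδ : 0 ≤ δ := (abs_nonneg _).trans (hf 0)
  have hbound : ∀ θ, |Real.exp (f θ) / Z - 1| ≤ Real.exp (2 * δ) - 1 := by
    intro θ
    have h1 := Real.exp_le_exp.2 (abs_le.1 (hf θ)).2
    have h2 := Real.exp_le_exp.2 (abs_le.1 (hf θ)).1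
    have u1 : Real.exp (f θ) / Z ≤ Real.exp (2 * δ) := by
      rw [div_le_iff₀ hZ0]
      calc _ ≤ Real.exp δ := h1
        _ = Real.exp (2 * δ) * Real.exp (-δ) := by rw [← Real.exp_add]; ring_nf
        _ ≤ _ := by gcongr
    have u2 : Real.exp (-(2 * δ)) ≤ Real.exp (f θ) / Z := by
      rw [le_div_iff₀ hZ0]
      calc _ ≤ Real.exp (-(2 * δ)) * Real.exp δ := by gcongr
        _ = Real.exp (-δ) := by rw [← Real.exp_add]; ring_nf
        _ ≤ _ := h2
    have u3 := Real.add_one_le_exp (2 * δ)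
    have u4 := Real.add_one_le_exp (-(2 * δ))
    rw [abs_le]
    constructor <;> linarith
  have hae : (fun θ => ((gibbs f : Measure UnitAddCircle).rnDeriv volume θ).toReal - 1) =ᵐ[volume]
      fun θ => Real.exp (f θ) / Z - 1 := by
    filter_upwards [rnDeriv_tilted_left_self (μ := (volume : Measure UnitAddCircle))
      f.continuous.aemeasurable] with θ hθ
    change ((((volume : Measure UnitAddCircle).tilted f).rnDeriv volume θ).toReal - 1) = _
    rw [hθ, ENNReal.toReal_ofReal (by positivity)]
  rw [l1DistUniform, eLpNorm_congr_ae hae]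
  refine (eLpNorm_le_of_ae_bound (ae_of_all _ hbound)).trans ?_
  simp

/-- If the uniform distribution is the only minimizer at `Kc`, then the dual functional at `Kc` is
positive away from `0`. By compactness this persists nearby, so minimizers at couplings
close to `Kc` have small Fourier coefficients. -/
lemma isContinuousTransition_of_unique (h : HasPositiveModes W c w) {Kc : ℝ} (hKc : 0 < Kc)
    (huniq : ∀ q, IsGlobalMinimizer W Kc q ↔ q = uniform) : IsContinuousTransition W Kc := by
  refine ⟨⟨uniform, (huniq _).2 rfl, fun q hq => (huniq q).1 hq⟩, fun q hq => ?_⟩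
  set D : (ℕ → ℂ) → ℝ := fun p => ∑' k, w k * ‖p k‖ with hD
  have hDnn : ∀ p, 0 ≤ D p := fun p =>
    tsum_nonneg fun k => mul_nonneg (h.pos k).le (norm_nonneg _)
  have hDc : Continuous fun p : ℕ → Metric.closedBall (0 : ℂ) 1 => D fun k => p k := by
    refine continuous_tsum (fun k => by fun_prop) h.summable fun k p => ?_
    rw [norm_mul, Real.norm_of_nonneg (h.pos k).le, norm_norm]
    exact mul_le_of_le_one_right (h.pos k).le (norm_coe_le_one p k)
  have hmin := (isGlobalMinimizer_uniform_iff h Kc).1 ((huniq _).2 rfl)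
  have hpos : ∀ p : ℕ → Metric.closedBall (0 : ℂ) 1, 0 < D (fun k => p k) →
      0 < dual w Kc fun k => p k := by
    intro p hDp
    by_contra hle
    have hle := not_lt.1 hle
    have hp := norm_coe_le_one p
    have hg := reducedEnergy_gibbs h Kc hp
    -- the Gibbs measure generated by `p` is then a minimizer at `Kc`, so it is uniform
    have hgle := (reducedEnergy_gibbs_le h hKc.le hp).trans hle
    have hu : gibbs (Kc • potential w fun k => p k) = uniform :=
      (huniq _).1 ((isGlobalMinimizer_iff h Kc _).2
        ⟨finiteEntropy_gibbs _, fun r hr => hgle.trans (hmin r hr)⟩)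
    rw [hu, reducedEnergy_uniform] at hg
    simp only [mode_uniform, sub_zero] at hg
    have hq0 : quad w (fun k => p k) ≤ 0 := by
      by_contra hlt
      have := mul_pos hKc (not_le.1 hlt)
      linarith
    have hs := h.summable_quad hp
    have hz : ∀ k, w k * ‖(p k : ℂ)‖ ^ 2 = 0 := by
      have : HasSum (fun k => w k * ‖(p k : ℂ)‖ ^ 2) 0 := by
        rw [quad] at hq0
        have h0 : ∑' k, w k * ‖(p k : ℂ)‖ ^ 2 = 0 :=
          le_antisymm (by linarith) (tsum_nonneg fun k => mul_nonneg (h.pos k).le (sq_nonneg _))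
        exact h0 ▸ hs.hasSum
      exact fun k => congr_fun ((hasSum_zero_iff_of_nonneg
        fun k => mul_nonneg (h.pos k).le (sq_nonneg _)).1 this) k
    have : D (fun k => p k) = 0 := by
      simp only [hD]
      refine (tsum_congr fun k => ?_).trans tsum_zero
      have := (mul_eq_zero.1 (hz k)).resolve_left (h.pos k).ne'
      rw [pow_eq_zero_iff two_ne_zero] at this
      rw [this, mul_zero]
    exact hDp.ne' this
  have hDlim : Tendsto (fun K => D (mode (q K))) (𝓝[>] Kc) (𝓝 0) := by
    refine tendsto_order.2 ⟨fun a ha => Eventually.of_forall fun K => ha.trans_le (hDnn _),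
      fun ε hε => ?_⟩
    have hcpt : IsCompact {p : ℕ → Metric.closedBall (0 : ℂ) 1 | ε ≤ D fun k => p k} :=
      (isClosed_le continuous_const hDc).isCompact
    have hev := hcpt.eventually_forall_of_forall_eventually (x₀ := Kc)
      (P := fun K p => 0 < dual w K fun k => p k) fun p hp =>
        (continuous_dual h).continuousAt.eventually_const_lt (hpos p (hε.trans_le hp))
    filter_upwards [nhdsWithin_le_nhds hev, self_mem_nhdsWithin] with K hK hKgt
    by_contra hge
    have h1 := hK (fun k => ⟨mode (q K) k, mem_closedBall_zero_iff.2 (norm_mode_le_one _ k)⟩)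
      (not_lt.1 hge)
    have h2 := hq K hKgt
    have h3 := dual_mode_le h K ((isGlobalMinimizer_iff h K _).1 h2).1
    exact absurd (h3.trans (h2.reducedEnergy_nonpos h)) (not_le.2 h1)
  have hlim : Tendsto (fun K => ENNReal.ofReal (Real.exp (2 * (K * (4 * D (mode (q K))))) - 1))
      (𝓝[>] Kc) (𝓝 0) := by
    have hid : Tendsto (fun K : ℝ => K) (𝓝[>] Kc) (𝓝 Kc) := tendsto_id.mono_left nhdsWithin_le_nhds
    have h1 := ((Real.continuous_exp.tendsto _).comp
      ((hid.mul (hDlim.const_mul 4)).const_mul 2)).sub_const 1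
    have h2 := ENNReal.tendsto_ofReal h1
    simpa using h2
  refine Tendsto.limsup_eq (tendsto_of_tendsto_of_tendsto_of_le_of_le' tendsto_const_nhds hlim
    (Eventually.of_forall fun K => zero_le) ?_)
  filter_upwards [self_mem_nhdsWithin] with K hKgt
  have hK0 : 0 ≤ K := (hKc.trans hKgt).le
  refine (congrArg l1DistUniform ((hq K hKgt).eq_gibbs h hK0)).trans_le
    (l1DistUniform_gibbs_le fun θ => ?_)
  change |K * potential w (mode (q K)) θ| ≤ _
  rw [abs_mul, abs_of_nonneg hK0]
  exact mul_le_mul_of_nonneg_left (abs_potential_le h (norm_mode_le_one _) θ) hK0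

/-! ### Discontinuous transitions -/

lemma enorm_mode_le_l1DistUniform {q : ProbabilityMeasure UnitAddCircle} (hq : FiniteEntropy q)
    (k : ℕ) : ‖mode q k‖ₑ ≤ l1DistUniform q := by
  have hac := (klDiv_ne_top_iff.1 hq).1
  set ρ : UnitAddCircle → ℝ := fun θ => ((q : Measure UnitAddCircle).rnDeriv volume θ).toReal
  have hρ : Integrable ρ := Measure.integrable_toReal_rnDeriv
  have h1 : mode q k = ∫ θ : UnitAddCircle, ρ θ • fourier ((k : ℤ) + 1) θ :=
    (integral_rnDeriv_smul hac).symm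
  have h2 : ∫ θ : UnitAddCircle, fourier ((k : ℤ) + 1) θ = 0 := by
    rw [integral_fourier_volume, if_neg (by omega)]
  have hi : Integrable fun θ : UnitAddCircle => ρ θ • fourier ((k : ℤ) + 1) θ :=
    hρ.smul_bdd 1 (by fun_prop) (ae_of_all _ fun θ => (norm_fourier_apply _ θ).le)
  have h3 : mode q k = ∫ θ : UnitAddCircle, (ρ θ - 1) • fourier ((k : ℤ) + 1) θ := by
    simp only [sub_smul, one_smul]
    rw [integral_sub hi (integrable_of_continuous (by fun_prop)), h2, sub_zero, h1]
  rw [h3, l1DistUniform, eLpNorm_one_eq_lintegral_enorm]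
  refine (enorm_integral_le_lintegral_enorm _).trans_eq (lintegral_congr fun θ => ?_)
  rw [enorm_smul, ← ofReal_norm (fourier _ θ), norm_fourier_apply, ENNReal.ofReal_one,
    mul_one]

/-- If the critical coupling is below the linear stability threshold, then the uniform
distribution is isolated among the minimizers at nearby couplings, so nonuniform minimizers above
`Kc` stay away from it. -/
lemma not_isContinuousTransition (h : HasPositiveModes W c w) {Kc : ℝ}
    (hKc : IsCriticalCoupling W Kc) (hlt : 2 * Kc * w 0 < 1) : ¬ IsContinuousTransition W Kc := by
  rintro ⟨-, hlim⟩
  have hex : ∀ K, ∃ q, Kc < K → q ≠ uniform ∧ IsGlobalMinimizer W K q := by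
    intro K
    by_cases hK : Kc < K
    · obtain ⟨q, hq⟩ := hKc.supercritical K hK
      exact ⟨q, fun _ => hq⟩
    · exact ⟨uniform, fun h => absurd h hK⟩
  choose q hq using hex
  have hl := hlim q fun K hK => (hq K hK).2
  have hpos := hKc.pos
  have hw0 := h.pos 0
  set κ := 2 * Kc * w 0 with hκ
  have hκ0 : 0 < κ := by positivity
  -- `δ` bounds the potential and is so small that the lower bound of the entropy still wins
  set δ : ℝ := (1 - κ) / 2 with hδ
  have hδ0 : 0 < δ := by rw [hδ]; linarith
  have hδ1 : δ ≤ 1 := by rw [hδ]; linarith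
  have hκδ : (1 + δ) * (2 * Kc * w 0) < 1 := by
    rw [← hκ]
    have : δ * κ < δ * 1 := mul_lt_mul_of_pos_left hlt hδ0
    rw [add_mul, one_mul]
    linarith
  set M : ℝ := ∑' k, w k with hM
  have hMpos : 0 < M := h.summable.tsum_pos (fun k => (h.pos k).le) 0 hw0
  set ε : ℝ := δ / (4 * (Kc + 1) * M) with hε
  have hε0 : 0 < ε := by positivity
  have ev1 : ∀ᶠ K in 𝓝[>] Kc, l1DistUniform (q K) < ENNReal.ofReal ε :=
    eventually_lt_of_limsup_lt (by rw [hl]; exact ENNReal.ofReal_pos.2 hε0)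
  have ev2 : ∀ᶠ K in 𝓝[>] Kc, (1 + δ) * (2 * K * w 0) < 1 := by
    refine nhdsWithin_le_nhds ?_
    have hc : Continuous fun K => (1 + δ) * (2 * K * w 0) := by fun_prop
    exact hc.continuousAt.eventually_lt_const hκδ
  have ev3 : ∀ᶠ K in 𝓝[>] Kc, K < Kc + 1 :=
    nhdsWithin_le_nhds (eventually_lt_nhds (lt_add_one Kc))
  obtain ⟨K, h1, h2, h3, h4⟩ := (ev1.and (ev2.and (ev3.and self_mem_nhdsWithin))).exists
  have h4 : Kc < K := h4
  have hK0 : 0 < K := hpos.trans h4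
  obtain ⟨hne, hmin⟩ := hq K h4
  have hfin := ((isGlobalMinimizer_iff h K _).1 hmin).1
  have hmode : ∀ k, ‖mode (q K) k‖ ≤ ε := by
    intro k
    have := (enorm_mode_le_l1DistUniform hfin k).trans h1.le
    rw [← ofReal_norm] at this
    exact (ENNReal.ofReal_le_ofReal_iff hε0.le).1 this
  have hsmall : ∀ θ, |K * potential w (mode (q K)) θ| ≤ δ := by
    intro θ
    have hp := norm_mode_le_one (q K)
    have hb := abs_potential_le h hp θ
    have hs : ∑' k, w k * ‖mode (q K) k‖ ≤ M * ε := by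
      rw [hM, ← tsum_mul_right]
      refine (summable_norm_mode h hp).tsum_le_tsum (fun k => ?_) (h.summable.mul_right ε)
      exact mul_le_mul_of_nonneg_left (hmode k) (h.pos k).le
    rw [abs_mul, abs_of_pos hK0]
    calc K * |potential w (mode (q K)) θ| ≤ (Kc + 1) * (4 * (M * ε)) := by
          refine mul_le_mul h3.le (hb.trans ?_) (abs_nonneg _) (by positivity)
          linarith
      _ = δ := by rw [hε]; field_simp
  have key := quad_le_entropy_of_small h hδ1 hfin hsmall
  have hred := hmin.reducedEnergy_nonpos h
  rw [reducedEnergy] at hred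
  have hent : 0 < entropy (q K) := by
    by_contra hle
    exact hne (eq_uniform_of_entropy_le_zero hfin (not_lt.1 hle))
  have hquad : 0 < K * quad w (mode (q K)) := by linarith
  have := lt_mul_of_one_lt_right hquad
    (show 1 < 2 - (1 + δ) * (2 * K * w 0) by linarith)
  linarith

end

/-! ### The Lebedev-Milin inequality -/

section

open Polynomial

/-- The Taylor coefficients at `0` of the exponential of a polynomial. -/
def expCoeff (φ : ℂ[X]) (k : ℕ) : ℂ :=
  (k.factorial : ℂ)⁻¹ * iteratedDeriv k (fun z => Complex.exp (φ.eval z)) 0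

lemma hasSum_expCoeff (φ : ℂ[X]) (z : ℂ) :
    HasSum (fun k => expCoeff φ k * z ^ k) (Complex.exp (φ.eval z)) := by
  have hd : Differentiable ℂ fun z => Complex.exp (φ.eval z) := φ.differentiable.cexp
  have := Complex.hasSum_taylorSeries_of_entire hd 0 z
  refine this.congr_fun fun k => ?_
  simp only [expCoeff, sub_zero, smul_eq_mul]
  ring

lemma expCoeff_zero {φ : ℂ[X]} (h : φ.coeff 0 = 0) : expCoeff φ 0 = 1 := by
  rw [coeff_zero_eq_eval_zero] at h
  simp [expCoeff, h]

lemma iteratedDeriv_eval_zero (P : ℂ[X]) (i : ℕ) :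
    iteratedDeriv i (fun z => P.eval z) 0 = i.factorial * P.coeff i := by
  induction i generalizing P with
  | zero => simp [coeff_zero_eq_eval_zero]
  | succ i ih =>
    have : deriv (fun z => P.eval z) = fun z => (derivative P).eval z := by
      funext z; exact P.deriv
    rw [iteratedDeriv_succ', this, ih, coeff_derivative, Nat.factorial_succ]
    push_cast
    ring

/-- The recursion for the coefficients of `exp φ` that expresses `(exp φ)' = φ' exp φ`. -/
lemma expCoeff_succ (φ : ℂ[X]) (k : ℕ) :
    ((k : ℂ) + 1) * expCoeff φ (k + 1) =
      ∑ j ∈ Finset.range (k + 1), ((j : ℂ) + 1) * φ.coeff (j + 1) * expCoeff φ (k - j) := by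
  have hd : deriv (fun z => Complex.exp (φ.eval z)) =
      (fun z => (derivative φ).eval z) * fun z => Complex.exp (φ.eval z) := by
    funext z
    rw [((φ.hasDerivAt z).cexp).deriv, Pi.mul_apply, mul_comm]
  have h1 : ContDiffAt ℂ k (fun z => (derivative φ).eval z) 0 :=
    (derivative φ).differentiable.contDiff.contDiffAt
  have h2 : ContDiffAt ℂ k (fun z => Complex.exp (φ.eval z)) 0 :=
    φ.differentiable.contDiff.cexp.contDiffAt
  rw [expCoeff, iteratedDeriv_succ', hd, iteratedDeriv_mul h1 h2, Finset.mul_sum, Finset.mul_sum]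
  refine Finset.sum_congr rfl fun j hj => ?_
  have hjk : j ≤ k := Nat.lt_succ_iff.1 (Finset.mem_range.1 hj)
  have e : (k.factorial : ℂ) = k.choose j * j.factorial * (k - j).factorial := by
    exact_mod_cast (Nat.choose_mul_factorial_mul_factorial hjk).symm
  have f1 : (k.choose j : ℂ) ≠ 0 := by exact_mod_cast (Nat.choose_pos hjk).ne'
  have f2 : (j.factorial : ℂ) ≠ 0 := by exact_mod_cast j.factorial_ne_zero
  have f3 : ((k - j).factorial : ℂ) ≠ 0 := by exact_mod_cast (k - j).factorial_ne_zero
  have f4 : (k : ℂ) + 1 ≠ 0 := by exact_mod_cast k.succ_ne_zero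
  rw [iteratedDeriv_eval_zero, coeff_derivative, expCoeff, Nat.factorial_succ, Nat.cast_mul, e]
  push_cast
  field_simp

/-- The polynomial `∑ a_j z ^ (j + 1)` over `j < N`. -/
def modePolynomial (a : ℕ → ℂ) (N : ℕ) : ℂ[X] :=
  ∑ j ∈ Finset.range N, monomial (j + 1) (a j)

lemma modePolynomial_coeff_zero (a : ℕ → ℂ) (N : ℕ) : (modePolynomial a N).coeff 0 = 0 := by
  simp [modePolynomial, finsetSum_coeff, coeff_monomial]

lemma modePolynomial_coeff_succ (a : ℕ → ℂ) (N j : ℕ) :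
    (modePolynomial a N).coeff (j + 1) = if j < N then a j else 0 := by
  simp [modePolynomial, finsetSum_coeff, coeff_monomial]

lemma eval_modePolynomial (a : ℕ → ℂ) (N : ℕ) (z : ℂ) :
    (modePolynomial a N).eval z = ∑ j ∈ Finset.range N, a j * z ^ (j + 1) := by
  simp [modePolynomial, eval_finsetSum, eval_monomial]

/-- The coefficients `(j + 1) |a_j| ^ 2` of the majorant of `∑ a_j z ^ (j + 1)`. -/
def majorant (a : ℕ → ℂ) (j : ℕ) : ℂ := (((j : ℝ) + 1) * ‖a j‖ ^ 2 : ℝ)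

/-- Milin's majorant: the recursion for the coefficients of `exp φ` and the Cauchy-Schwarz
inequality give the recursion for the coefficients of the exponential of the majorant. -/
lemma norm_expCoeff_sq_le (a : ℕ → ℂ) (N k : ℕ) :
    ‖expCoeff (modePolynomial a N) k‖ ^ 2 ≤
      (expCoeff (modePolynomial (majorant a) N) k).re := by
  induction k using Nat.strong_induction_on with
  | _ k ih =>
    cases k with
    | zero =>
      rw [expCoeff_zero (modePolynomial_coeff_zero _ _),
        expCoeff_zero (modePolynomial_coeff_zero _ _)]
      simp
    | succ k =>
      set b := expCoeff (modePolynomial a N)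
      set B := expCoeff (modePolynomial (majorant a) N)
      set α : ℕ → ℝ := fun j => if j < N then ‖a j‖ else 0 with hα
      have hcoef : ∀ j, ‖(modePolynomial a N).coeff (j + 1)‖ = α j := by
        intro j
        rw [modePolynomial_coeff_succ]
        by_cases h : j < N <;> simp [hα, h]
      have hmaj : ∀ j, (modePolynomial (majorant a) N).coeff (j + 1) =
          (((j : ℝ) + 1) * α j ^ 2 : ℝ) := by
        intro j
        rw [modePolynomial_coeff_succ]
        by_cases h : j < N <;> simp [hα, h, majorant]
      have hb : ((k : ℝ) + 1) * ‖b (k + 1)‖ ≤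
          ∑ j ∈ Finset.range (k + 1), ((j : ℝ) + 1) * α j * ‖b (k - j)‖ := by
        have h := congrArg norm (expCoeff_succ (modePolynomial a N) k)
        rw [norm_mul] at h
        have e : ∀ n : ℕ, ‖(n : ℂ) + 1‖ = (n : ℝ) + 1 := fun n => by
          rw [← Nat.cast_succ, Complex.norm_natCast, Nat.cast_succ]
        rw [e] at h
        rw [h]
        refine (norm_sum_le _ _).trans_eq (Finset.sum_congr rfl fun j _ => ?_)
        rw [norm_mul, norm_mul, e, hcoef]
      have hB : ((k : ℝ) + 1) * (B (k + 1)).re =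
          ∑ j ∈ Finset.range (k + 1), ((j : ℝ) + 1) * (((j : ℝ) + 1) * α j ^ 2) *
            (B (k - j)).re := by
        have h := congrArg Complex.re (expCoeff_succ (modePolynomial (majorant a) N) k)
        have e : ((k : ℂ) + 1) = (((k : ℝ) + 1 : ℝ) : ℂ) := by push_cast; rfl
        rw [e, Complex.re_ofReal_mul, Complex.re_sum] at h
        rw [h]
        refine Finset.sum_congr rfl fun j _ => ?_
        have e2 : ((j : ℂ) + 1) = (((j : ℝ) + 1 : ℝ) : ℂ) := by push_cast; rfl
        rw [hmaj, e2, ← Complex.ofReal_mul, Complex.re_ofReal_mul]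
      have hk : (0 : ℝ) < (k : ℝ) + 1 := by positivity
      refine le_of_mul_le_mul_left ?_ (pow_pos hk 2)
      calc ((k : ℝ) + 1) ^ 2 * ‖b (k + 1)‖ ^ 2 = (((k : ℝ) + 1) * ‖b (k + 1)‖) ^ 2 := by ring
        _ ≤ (∑ j ∈ Finset.range (k + 1), ((j : ℝ) + 1) * α j * ‖b (k - j)‖) ^ 2 :=
            pow_le_pow_left₀ (by positivity) hb 2
        _ ≤ (Finset.range (k + 1)).card *
            ∑ j ∈ Finset.range (k + 1), (((j : ℝ) + 1) * α j * ‖b (k - j)‖) ^ 2 :=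
            sq_sum_le_card_mul_sum_sq
        _ ≤ ((k : ℝ) + 1) * ∑ j ∈ Finset.range (k + 1),
            ((j : ℝ) + 1) * (((j : ℝ) + 1) * α j ^ 2) * (B (k - j)).re := by
            rw [Finset.card_range, Nat.cast_succ]
            refine mul_le_mul_of_nonneg_left (Finset.sum_le_sum fun j hj => ?_) hk.le
            have := mul_le_mul_of_nonneg_left (ih (k - j) (by omega))
              (show 0 ≤ ((j : ℝ) + 1) * (((j : ℝ) + 1) * α j ^ 2) by positivity)
            refine le_trans (le_of_eq ?_) this
            ring
        _ = ((k : ℝ) + 1) ^ 2 * (B (k + 1)).re := by rw [← hB]; ring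

lemma expCoeff_one {φ : ℂ[X]} (h : φ.coeff 0 = 0) : expCoeff φ 1 = φ.coeff 1 := by
  have := expCoeff_succ φ 0
  simpa [expCoeff_zero h] using this

lemma expCoeff_two {φ : ℂ[X]} (h : φ.coeff 0 = 0) :
    expCoeff φ 2 = φ.coeff 1 ^ 2 / 2 + φ.coeff 2 := by
  have := expCoeff_succ φ 1
  simp only [Finset.sum_range_succ, Finset.sum_range_zero, expCoeff_zero h, expCoeff_one h] at this
  norm_num [expCoeff_zero h, expCoeff_one h] at this
  linear_combination this / 2

lemma expCoeff_three {φ : ℂ[X]} (h : φ.coeff 0 = 0) (h3 : φ.coeff 3 = 0) :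
    expCoeff φ 3 = φ.coeff 1 * (φ.coeff 1 ^ 2 / 2 + 3 * φ.coeff 2) / 3 := by
  have := expCoeff_succ φ 2
  simp only [Finset.sum_range_succ, Finset.sum_range_zero] at this
  norm_num [expCoeff_zero h, expCoeff_one h, expCoeff_two h, h3] at this
  linear_combination this / 3

/-- For a nonzero polynomial of degree at most two, one of the inequalities for the coefficients of
order two and three is strict. -/
lemma norm_expCoeff_sq_lt {a : ℕ → ℂ} (ha : a 0 ≠ 0 ∨ a 1 ≠ 0) :
    ∃ k, ‖expCoeff (modePolynomial a 2) k‖ ^ 2 <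
      (expCoeff (modePolynomial (majorant a) 2) k).re := by
  have c0 := modePolynomial_coeff_zero a 2
  have C0 := modePolynomial_coeff_zero (majorant a) 2
  have c1 : (modePolynomial a 2).coeff 1 = a 0 := modePolynomial_coeff_succ a 2 0
  have c2 : (modePolynomial a 2).coeff 2 = a 1 := modePolynomial_coeff_succ a 2 1
  have c3 : (modePolynomial a 2).coeff 3 = 0 := modePolynomial_coeff_succ a 2 2
  have C1 : (modePolynomial (majorant a) 2).coeff 1 = ((‖a 0‖ ^ 2 : ℝ) : ℂ) := by
    refine (modePolynomial_coeff_succ (majorant a) 2 0).trans ?_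
    simp [majorant]
  have C2 : (modePolynomial (majorant a) 2).coeff 2 = ((2 * ‖a 1‖ ^ 2 : ℝ) : ℂ) := by
    refine (modePolynomial_coeff_succ (majorant a) 2 1).trans ?_
    simp [majorant]; norm_num
  have C3 : (modePolynomial (majorant a) 2).coeff 3 = 0 :=
    modePolynomial_coeff_succ (majorant a) 2 2
  by_cases h0 : a 0 = 0
  · have h1 : a 1 ≠ 0 := ha.resolve_left (not_not.2 h0)
    refine ⟨2, ?_⟩
    rw [expCoeff_two c0, expCoeff_two C0, c1, c2, C1, C2, h0]
    have : 0 < ‖a 1‖ := norm_pos_iff.2 h1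
    simp only [zero_pow two_ne_zero, Complex.ofReal_zero, norm_zero, zero_div, zero_add,
      Complex.ofReal_re]
    nlinarith
  -- the gap is at least `‖a 0‖ ^ 2` times a positive definite form in `‖a 0‖ ^ 2, ‖a 1‖`
  · refine ⟨3, ?_⟩
    have hx : 0 < ‖a 0‖ := norm_pos_iff.2 h0
    rw [expCoeff_three c0 c3, expCoeff_three C0 C3, c1, c2, C1, C2]
    have e : (((‖a 0‖ ^ 2 : ℝ) : ℂ) * (((‖a 0‖ ^ 2 : ℝ) : ℂ) ^ 2 / 2 +
        3 * ((2 * ‖a 1‖ ^ 2 : ℝ) : ℂ)) / 3) =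
        ((‖a 0‖ ^ 2 * ((‖a 0‖ ^ 2) ^ 2 / 2 + 3 * (2 * ‖a 1‖ ^ 2)) / 3 : ℝ) : ℂ) := by
      push_cast; rfl
    rw [e, Complex.ofReal_re, norm_div, norm_mul]
    have hn : ‖a 0 ^ 2 / 2 + 3 * a 1‖ ≤ ‖a 0‖ ^ 2 / 2 + 3 * ‖a 1‖ := by
      refine (norm_add_le _ _).trans_eq ?_
      simp
    have h3 : ‖(3 : ℂ)‖ = 3 := by norm_num
    rw [h3]
    have hy := norm_nonneg (a 1)
    set x := ‖a 0‖
    set y := ‖a 1‖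
    have hsq := pow_le_pow_left₀ (norm_nonneg _) hn 2
    have key : (x ^ 2 / 2 + 3 * y) ^ 2 < 3 * (x ^ 4 / 2 + 6 * y ^ 2) := by
      have : 0 < x ^ 4 := by positivity
      nlinarith [sq_nonneg (x ^ 2 - 3 * y), sq_nonneg y]
    have hx2 : 0 < x ^ 2 := by positivity
    calc (x * ‖a 0 ^ 2 / 2 + 3 * a 1‖ / 3) ^ 2 = x ^ 2 * ‖a 0 ^ 2 / 2 + 3 * a 1‖ ^ 2 / 9 := by ring
      _ < x ^ 2 * (3 * (x ^ 4 / 2 + 6 * y ^ 2)) / 9 := by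
          have := hsq.trans_lt key
          gcongr
      _ = _ := by ring

lemma fourier_natCast (k : ℕ) (θ : UnitAddCircle) :
    fourier (k : ℤ) θ = (fourier 1 θ) ^ k := by
  induction k with
  | zero => simp
  | succ k ih => rw [Nat.cast_succ, fourier_add, ih, pow_succ]

lemma integral_conj_fourier_mul_fourier (j k : ℤ) :
    ∫ θ : UnitAddCircle, conj (fourier k θ) * fourier j θ = if j = k then 1 else 0 := by
  simp only [← fourier_neg, ← fourier_add, integral_fourier_volume]
  congr 1
  exact propext ⟨fun h => by omega, fun h => by omega⟩

/-- Parseval's identity for an absolutely convergent series of nonnegative frequencies. -/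
lemma hasSum_norm_sq {b : ℕ → ℂ} (hb : Summable fun k => ‖b k‖) :
    HasSum (fun k => ‖b k‖ ^ 2)
      (∫ θ : UnitAddCircle, ‖∑' k, b k * fourier (k : ℤ) θ‖ ^ 2) := by
  set F : UnitAddCircle → ℂ := fun θ => ∑' k, b k * fourier (k : ℤ) θ with hF
  have hterm : ∀ k θ, ‖b k * fourier (k : ℤ) (θ : UnitAddCircle)‖ ≤ ‖b k‖ := fun k θ => by
    rw [norm_mul, norm_fourier_apply, mul_one]
  have hFc : Continuous F := continuous_tsum (fun k => by fun_prop) hb hterm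
  have inner : ∀ k : ℕ, ∫ θ : UnitAddCircle, conj (fourier (k : ℤ) θ) * F θ = b k := by
    intro k
    have key := hasSum_integral_of_norm_le (volume : Measure UnitAddCircle)
      (F := fun j θ => conj (fourier (k : ℤ) θ) * (b j * fourier (j : ℤ) θ))
      (fun j => by fun_prop) hb (fun j θ => by
        rw [norm_mul, RCLike.norm_conj, norm_fourier_apply, one_mul]
        exact hterm j θ)
    simp only [tsum_mul_left] at key
    refine key.unique ?_
    have e : ∀ j : ℕ, ∫ θ : UnitAddCircle, conj (fourier (k : ℤ) θ) * (b j * fourier (j : ℤ) θ) =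
        if j = k then b k else 0 := by
      intro j
      simp only [mul_left_comm _ (b j)]
      rw [integral_const_mul, integral_conj_fourier_mul_fourier]
      by_cases h : j = k
      · subst h; simp
      · rw [if_neg (by exact_mod_cast h), if_neg h, mul_zero]
    simp only [e]
    exact hasSum_ite_eq k (b k)
  obtain ⟨C, hC⟩ : ∃ C, ∀ θ, ‖F θ‖ ≤ C := by
    refine ⟨∑' k, ‖b k‖, fun θ => tsum_of_norm_bounded hb.hasSum fun k => hterm k θ⟩
  have key := hasSum_integral_of_norm_le (volume : Measure UnitAddCircle)
    (F := fun k θ => b k * fourier (k : ℤ) θ * conj (F θ)) (u := fun k => ‖b k‖ * C)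
    (fun k => by fun_prop) (hb.mul_right C) (fun k θ => by
      rw [norm_mul, RCLike.norm_conj]
      exact mul_le_mul (hterm k θ) (hC θ) (norm_nonneg _) (norm_nonneg _))
  have e1 : ∀ k : ℕ, ∫ θ : UnitAddCircle, b k * fourier (k : ℤ) θ * conj (F θ) =
      ((‖b k‖ ^ 2 : ℝ) : ℂ) := by
    intro k
    have h1 : ∀ θ : UnitAddCircle, b k * fourier (k : ℤ) θ * conj (F θ) =
        b k * conj (conj (fourier (k : ℤ) θ) * F θ) := fun θ => by
      rw [map_mul, Complex.conj_conj, mul_assoc]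
    simp only [h1]
    rw [integral_const_mul, integral_conj, inner, Complex.mul_conj, Complex.normSq_eq_norm_sq]
  have e2 : ∀ θ, ∑' k, b k * fourier (k : ℤ) θ * conj (F θ) = ((‖F θ‖ ^ 2 : ℝ) : ℂ) := by
    intro θ
    rw [tsum_mul_right, ← Complex.normSq_eq_norm_sq, ← Complex.mul_conj]
  simp only [e1, e2] at key
  rw [integral_complex_ofReal] at key
  exact Complex.hasSum_ofReal.1 key

/-- The trigonometric polynomial `2 Re φ(exp (2 π i θ))`. -/
def twiceRe (φ : ℂ[X]) : C(UnitAddCircle, ℝ) where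
  toFun θ := 2 * (φ.eval (fourier 1 θ)).re
  continuous_toFun :=
    continuous_const.mul (Complex.continuous_re.comp (φ.continuous.comp (map_continuous _)))

lemma hasSum_partition (φ : ℂ[X]) :
    HasSum (fun k => ‖expCoeff φ k‖ ^ 2) (∫ θ : UnitAddCircle, Real.exp (twiceRe φ θ)) := by
  have hs : Summable fun k => ‖expCoeff φ k‖ := by
    have := (hasSum_expCoeff φ 1).summable.norm
    simpa using this
  convert hasSum_norm_sq hs using 1
  refine integral_congr_ae (ae_of_all _ fun θ => ?_)
  have e : ∑' k, expCoeff φ k * fourier (k : ℤ) θ = Complex.exp (φ.eval (fourier 1 θ)) := by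
    simp only [fourier_natCast]
    exact (hasSum_expCoeff φ _).tsum_eq
  simp only [e, Complex.norm_exp, twiceRe, ContinuousMap.coe_mk, ← Real.exp_nat_mul,
    Nat.cast_ofNat]

lemma hasSum_majorant (a : ℕ → ℂ) (N : ℕ) :
    HasSum (fun k => (expCoeff (modePolynomial (majorant a) N) k).re)
      (Real.exp (∑ j ∈ Finset.range N, ((j : ℝ) + 1) * ‖a j‖ ^ 2)) := by
  have h := Complex.hasSum_re (hasSum_expCoeff (modePolynomial (majorant a) N) 1)
  have e : (modePolynomial (majorant a) N).eval 1 =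
      ((∑ j ∈ Finset.range N, ((j : ℝ) + 1) * ‖a j‖ ^ 2 : ℝ) : ℂ) := by
    rw [eval_modePolynomial, Complex.ofReal_sum]
    simp [majorant]
  rw [e, ← Complex.ofReal_exp, Complex.ofReal_re] at h
  simpa using h

/-- The Lebedev-Milin inequality. -/
lemma logPartition_twiceRe_le (a : ℕ → ℂ) (N : ℕ) :
    logPartition (twiceRe (modePolynomial a N)) ≤
      ∑ j ∈ Finset.range N, ((j : ℝ) + 1) * ‖a j‖ ^ 2 := by
  rw [logPartition, Real.log_le_iff_le_exp (partition_pos _)]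
  exact hasSum_le (norm_expCoeff_sq_le a N) (hasSum_partition _) (hasSum_majorant a N)

lemma logPartition_twiceRe_lt {a : ℕ → ℂ} (ha : a 0 ≠ 0 ∨ a 1 ≠ 0) :
    logPartition (twiceRe (modePolynomial a 2)) <
      ∑ j ∈ Finset.range 2, ((j : ℝ) + 1) * ‖a j‖ ^ 2 := by
  obtain ⟨k, hk⟩ := norm_expCoeff_sq_lt ha
  rw [logPartition, Real.log_lt_iff_lt_exp (partition_pos _)]
  exact hasSum_lt (norm_expCoeff_sq_le a 2) hk (hasSum_partition _) (hasSum_majorant a 2)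

lemma twiceRe_modePolynomial_apply (a : ℕ → ℂ) (N : ℕ) (θ : UnitAddCircle) :
    twiceRe (modePolynomial a N) θ =
      ∑ j ∈ Finset.range N, 2 * (a j * fourier ((j : ℤ) + 1) θ).re := by
  change 2 * ((modePolynomial a N).eval (fourier 1 θ)).re = _
  rw [eval_modePolynomial, Complex.re_sum, Finset.mul_sum]
  refine Finset.sum_congr rfl fun j _ => ?_
  rw [← fourier_natCast, Nat.cast_succ]

lemma integral_twiceRe_modePolynomial (q : ProbabilityMeasure UnitAddCircle) (a : ℕ → ℂ) (N : ℕ) :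
    ∫ θ, twiceRe (modePolynomial a N) θ ∂(q : Measure UnitAddCircle) =
      ∑ j ∈ Finset.range N, 2 * (a j * mode q j).re := by
  simp only [twiceRe_modePolynomial_apply]
  rw [integral_finsetSum _ fun j _ => integrable_of_continuous (by fun_prop)]
  refine Finset.sum_congr rfl fun j _ => ?_
  have := integral_re_fourier_mul (q : Measure UnitAddCircle) (a j) ((j : ℤ) + 1)
    (g := fun _ => 1) continuous_const
  simp only [mul_one, Complex.ofReal_one] at this
  rw [integral_const_mul, this]
  rfl

/-- The coefficients of the optimal test potential for `q` in the duality between the Lebedev-Milin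
inequality and the lower bound for the entropy. -/
def dualCoeff (q : ProbabilityMeasure UnitAddCircle) (j : ℕ) : ℂ :=
  conj (mode q j) / ((j : ℂ) + 1)

lemma norm_dualCoeff_sq (q : ProbabilityMeasure UnitAddCircle) (j : ℕ) :
    ((j : ℝ) + 1) * ‖dualCoeff q j‖ ^ 2 = ‖mode q j‖ ^ 2 / ((j : ℝ) + 1) := by
  have e : ‖(j : ℂ) + 1‖ = (j : ℝ) + 1 := by
    rw [← Nat.cast_succ, Complex.norm_natCast, Nat.cast_succ]
  have : (0 : ℝ) < (j : ℝ) + 1 := by positivity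
  rw [dualCoeff, norm_div, RCLike.norm_conj, e]
  field_simp

lemma integral_twiceRe_dualCoeff (q : ProbabilityMeasure UnitAddCircle) (N : ℕ) :
    ∫ θ, twiceRe (modePolynomial (dualCoeff q) N) θ ∂(q : Measure UnitAddCircle) =
      2 * ∑ j ∈ Finset.range N, ‖mode q j‖ ^ 2 / ((j : ℝ) + 1) := by
  rw [integral_twiceRe_modePolynomial, Finset.mul_sum]
  refine Finset.sum_congr rfl fun j _ => ?_
  have e : dualCoeff q j * mode q j = ((‖mode q j‖ ^ 2 / ((j : ℝ) + 1) : ℝ) : ℂ) := by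
    rw [dualCoeff, div_mul_eq_mul_div, mul_comm, Complex.mul_conj, Complex.normSq_eq_norm_sq]
    push_cast
    rfl
  rw [e, Complex.ofReal_re]

/-- The logarithmic Hardy-Littlewood-Sobolev inequality on the circle, dual to the Lebedev-Milin
inequality. -/
lemma sum_mode_sq_div_le_entropy {q : ProbabilityMeasure UnitAddCircle} (hq : FiniteEntropy q)
    (N : ℕ) : ∑ j ∈ Finset.range N, ‖mode q j‖ ^ 2 / ((j : ℝ) + 1) ≤ entropy q := by
  have h1 := integral_sub_logPartition_le_entropy hq (twiceRe (modePolynomial (dualCoeff q) N))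
  have h2 := logPartition_twiceRe_le (dualCoeff q) N
  rw [integral_twiceRe_dualCoeff] at h1
  simp only [norm_dualCoeff_sq] at h2
  linarith

lemma sum_mode_sq_div_lt_entropy {q : ProbabilityMeasure UnitAddCircle} (hq : FiniteEntropy q)
    (hm : mode q 0 ≠ 0 ∨ mode q 1 ≠ 0) :
    ‖mode q 0‖ ^ 2 + ‖mode q 1‖ ^ 2 / 2 < entropy q := by
  have h1 := integral_sub_logPartition_le_entropy hq (twiceRe (modePolynomial (dualCoeff q) 2))
  have hd : dualCoeff q 0 ≠ 0 ∨ dualCoeff q 1 ≠ 0 := by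
    refine hm.imp (fun h => ?_) fun h => ?_ <;>
    · rw [dualCoeff]
      refine div_ne_zero ((_root_.map_ne_zero _).2 h) ?_
      norm_num
  have h2 := logPartition_twiceRe_lt hd
  rw [integral_twiceRe_dualCoeff] at h1
  simp only [norm_dualCoeff_sq] at h2
  norm_num [Finset.sum_range_succ] at h1 h2
  linarith

/-! ### Unstable couplings -/

section

variable {W : C(UnitAddCircle, ℝ)} {c : ℝ} {w : ℕ → ℝ}

/-- A test of instability with two modes. The partition function is bounded below by the first
three terms of Parseval's identity. -/
lemma not_isGlobalMinimizer_uniform (h : HasPositiveModes W c w) {K x y : ℝ} (hK : 0 ≤ K)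
    (hx : |x| ≤ 1) (hy : |y| ≤ 1)
    (hlt : 2 * K * w 0 * x ^ 2 + 2 * K * w 1 * y ^ 2 <
      Real.log (1 + (2 * K * w 0 * x) ^ 2 +
        ((2 * K * w 0 * x) ^ 2 / 2 + 2 * K * w 1 * y) ^ 2)) :
    ¬ IsGlobalMinimizer W K uniform := by
  rw [isGlobalMinimizer_uniform_iff h]
  intro hmin
  set p : ℕ → ℂ := fun k => if k = 0 then (x : ℂ) else if k = 1 then (y : ℂ) else 0 with hpdef
  have p0 : p 0 = x := by simp [hpdef]
  have p1 : p 1 = y := by simp [hpdef]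
  have p2 : ∀ k ∉ Finset.range 2, p k = 0 := by
    intro k hk
    rw [Finset.mem_range] at hk
    simp only [hpdef]
    rw [if_neg (by omega), if_neg (by omega)]
  have hp : ∀ k, ‖p k‖ ≤ 1 := by
    intro k
    simp only [hpdef]
    split_ifs
    · simpa using hx
    · simpa using hy
    · simp
  set a : ℕ → ℂ := fun k => 2 * K * w k * conj (p k) with ha
  have hpot : K • potential w p = twiceRe (modePolynomial a 2) := by
    ext θ
    rw [twiceRe_modePolynomial_apply]
    change K * potential w p θ = _
    rw [potential_apply h hp, tsum_eq_sum (s := Finset.range 2) fun k hk => by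
      simp [potentialTerm, p2 k hk], Finset.mul_sum]
    refine Finset.sum_congr rfl fun k _ => ?_
    have e : a k * fourier ((k : ℤ) + 1) θ =
        ((2 * K * w k : ℝ) : ℂ) * (conj (p k) * fourier ((k : ℤ) + 1) θ) := by
      simp only [ha]; push_cast; ring
    rw [e, Complex.re_ofReal_mul]
    change K * (4 * w k * _) = _
    ring
  have hquad : quad w p = 2 * (w 0 * x ^ 2 + w 1 * y ^ 2) := by
    rw [quad, tsum_eq_sum (s := Finset.range 2) fun k hk => by simp [p2 k hk]]
    simp [Finset.sum_range_succ, p0, p1]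
  have c0 := modePolynomial_coeff_zero a 2
  have c1 : (modePolynomial a 2).coeff 1 = ((2 * K * w 0 * x : ℝ) : ℂ) := by
    refine (modePolynomial_coeff_succ a 2 0).trans ?_
    simp [ha, p0]
  have c2 : (modePolynomial a 2).coeff 2 = ((2 * K * w 1 * y : ℝ) : ℂ) := by
    refine (modePolynomial_coeff_succ a 2 1).trans ?_
    simp [ha, p1]
  have hpart : 1 + (2 * K * w 0 * x) ^ 2 + ((2 * K * w 0 * x) ^ 2 / 2 + 2 * K * w 1 * y) ^ 2 ≤
      ∫ θ : UnitAddCircle, Real.exp (twiceRe (modePolynomial a 2) θ) := by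
    have hs := sum_le_hasSum (Finset.range 3) (fun k _ => sq_nonneg _)
      (hasSum_partition (modePolynomial a 2))
    refine le_trans (le_of_eq ?_) hs
    have e2 : ((2 * K * w 0 * x : ℝ) : ℂ) ^ 2 / 2 + ((2 * K * w 1 * y : ℝ) : ℂ) =
        (((2 * K * w 0 * x) ^ 2 / 2 + 2 * K * w 1 * y : ℝ) : ℂ) := by push_cast; rfl
    simp only [Finset.sum_range_succ, Finset.sum_range_zero, expCoeff_zero c0, expCoeff_one c0,
      expCoeff_two c0, c1, c2, e2, Complex.norm_real, Real.norm_eq_abs, sq_abs]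
    simp
  have hlog := Real.log_le_log (by positivity) hpart
  have hdual := reducedEnergy_gibbs_le h hK hp
  have hnn := hmin _ (finiteEntropy_gibbs (K • potential w p))
  rw [dual, hpot, hquad, logPartition] at hdual
  rw [hpot] at hnn
  linarith

lemma not_isGlobalMinimizer_uniform_of_one_lt (h : HasPositiveModes W c w) {K : ℝ}
    (hK : 1 < 2 * K * w 0) : ¬ IsGlobalMinimizer W K uniform := by
  have hw := h.pos 0
  set κ := 2 * K * w 0 with hκ
  have hK0 : 0 ≤ K := by
    by_contra hneg
    have := mul_neg_of_neg_of_pos (not_le.1 hneg) hw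
    linarith
  -- any amplitude with `κ ^ 2 * x ^ 2 < 2 * (κ - 1)` works in `log (1 + u) ≥ 2 u / (u + 2)`
  set x : ℝ := (κ - 1) / κ ^ 2 with hx
  have hx0 : 0 < x := div_pos (by linarith) (by positivity)
  have hx1 : x ≤ 1 := (div_le_one (by positivity)).2 (by nlinarith)
  refine not_isGlobalMinimizer_uniform h hK0 (x := x) (y := 0) (by rwa [abs_of_pos hx0])
    (by simp) ?_
  rw [← hκ]
  have h1 : κ ^ 2 * x = κ - 1 := by rw [hx]; field_simp
  have h2 : (κ * x) ^ 2 ≤ κ - 1 := by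
    calc (κ * x) ^ 2 = κ ^ 2 * x * x := by ring
      _ ≤ κ ^ 2 * x * 1 := by gcongr
      _ = κ - 1 := by rw [mul_one, h1]
  have h3 := Real.le_log_one_add_of_nonneg (sq_nonneg (κ * x))
  have h4 : κ * x ^ 2 < 2 * (κ * x) ^ 2 / ((κ * x) ^ 2 + 2) := by
    rw [lt_div_iff₀ (by positivity)]
    have : κ * x ^ 2 * ((κ * x) ^ 2 + 2) < κ * x ^ 2 * (2 * κ) := by
      refine mul_lt_mul_of_pos_left (by linarith) ?_
      have : 0 < κ := by linarith
      positivity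
    linarith
  have h5 : Real.log (1 + (κ * x) ^ 2) ≤
      Real.log (1 + (κ * x) ^ 2 + ((κ * x) ^ 2 / 2 + 2 * K * w 1 * 0) ^ 2) :=
    Real.log_le_log (by positivity) (by linarith [sq_nonneg ((κ * x) ^ 2 / 2 + 2 * K * w 1 * 0)])
  linarith

/-- At the linear stability threshold the uniform distribution is unstable along the extremals
`a_1 = x`, `a_2 = x ^ 2 / 2` of the Lebedev-Milin inequality when the second mode exceeds half of
the first one. -/
lemma not_isGlobalMinimizer_uniform_of_threshold (h : HasPositiveModes W c w) {K : ℝ}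
    (hK : 2 * K * w 0 = 1) (hK1 : 1 / 2 < 2 * K * w 1) : ¬ IsGlobalMinimizer W K uniform := by
  have hw := h.pos 0
  have hK0 : 0 ≤ K := by
    by_contra hneg
    have := mul_neg_of_neg_of_pos (not_le.1 hneg) hw
    linarith
  set l := 2 * K * w 1 with hl
  have hl0 : 0 < l := by linarith
  set γ : ℝ := 1 / (4 * l) with hγ
  have hγ0 : 0 < γ := by positivity
  have hγ1 : γ < 1 / 2 := by
    rw [hγ, div_lt_div_iff₀ (by positivity) (by positivity)]
    linarith
  -- the gain of order `x ^ 4` is `1 / 2 - γ`, and `x` is so small that it beats the higher orders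
  set x : ℝ := (1 - 2 * γ) / 3 with hx
  have hx0 : 0 < x := by rw [hx]; linarith
  have hx1 : x ≤ 1 := by rw [hx]; linarith
  set s : ℝ := x ^ 2 with hs
  have hs0 : 0 < s := by positivity
  have hsx : s ≤ x := by
    rw [hs, sq]; exact mul_le_of_le_one_left hx0.le hx1
  have hy : l * (2 * γ * s) = s / 2 := by rw [hγ]; field_simp; norm_num
  refine not_isGlobalMinimizer_uniform h hK0 (x := x) (y := 2 * γ * s)
    (by rwa [abs_of_pos hx0]) ?_ ?_
  · rw [abs_of_pos (by positivity)]
    nlinarith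
  · rw [hK, ← hl, hy, one_mul, one_mul, ← hs]
    have e1 : l * (2 * γ * s) ^ 2 = γ * s ^ 2 := by
      calc l * (2 * γ * s) ^ 2 = l * (2 * γ * s) * (2 * γ * s) := by ring
        _ = γ * s ^ 2 := by rw [hy]; ring
    rw [e1]
    have h3 := Real.le_log_one_add_of_nonneg (show 0 ≤ s + s ^ 2 by positivity)
    have e2 : 1 + s + (s / 2 + s / 2) ^ 2 = 1 + (s + s ^ 2) := by ring
    rw [e2]
    refine lt_of_lt_of_le ?_ h3
    rw [lt_div_iff₀ (by positivity)]
    have h4 : (1 + γ) * s + γ * s ^ 2 < 1 - 2 * γ := by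
      have : s ^ 2 ≤ s := by rw [sq]; exact mul_le_of_le_one_left hs0.le (hsx.trans hx1)
      nlinarith
    have h5 := mul_lt_mul_of_pos_left h4 (show 0 < s ^ 2 by positivity)
    nlinarith

end

end

/-! ### Uniqueness at the linear stability threshold -/

section

variable {W : C(UnitAddCircle, ℝ)} {c : ℝ} {w : ℕ → ℝ}

lemma half_pow_le_inv_succ (k : ℕ) : (1 / 2 : ℝ) ^ k ≤ 1 / ((k : ℝ) + 1) := by
  rw [one_div_pow]
  refine one_div_le_one_div_of_le (by positivity) ?_
  exact_mod_cast Nat.lt_two_pow_self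

lemma half_pow_lt_inv_succ {k : ℕ} (hk : 2 ≤ k) : (1 / 2 : ℝ) ^ k < 1 / ((k : ℝ) + 1) := by
  rw [one_div_pow]
  refine one_div_lt_one_div_of_lt (by positivity) ?_
  have : k + 1 < 2 ^ k := by
    induction k, hk using Nat.le_induction with
    | base => norm_num
    | succ k _ ih => rw [pow_succ]; omega
  exact_mod_cast this

/-- If the Fourier coefficients decay at least like `2 ^ (-k)`, the logarithmic
Hardy-Littlewood-Sobolev inequality dominates the interaction energy at the linear stability
threshold. -/
lemma isGlobalMinimizer_iff_eq_uniform (h : HasPositiveModes W c w) {K : ℝ} (hK : 0 ≤ K)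
    (hdecay : ∀ k, 2 * K * w k ≤ (1 / 2) ^ k) (q : ProbabilityMeasure UnitAddCircle) :
    IsGlobalMinimizer W K q ↔ q = uniform := by
  set f : ProbabilityMeasure UnitAddCircle → ℕ → ℝ := fun q k => 2 * K * w k * ‖mode q k‖ ^ 2
    with hf
  set g : ProbabilityMeasure UnitAddCircle → ℕ → ℝ := fun q k => ‖mode q k‖ ^ 2 / ((k : ℝ) + 1)
    with hg
  have hfg' : ∀ q k, f q k ≤ (1 / 2) ^ k * ‖mode q k‖ ^ 2 := fun q k =>
    mul_le_mul_of_nonneg_right (hdecay k) (sq_nonneg _)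
  have hg' : ∀ q k, g q k = 1 / ((k : ℝ) + 1) * ‖mode q k‖ ^ 2 := fun q k => by
    simp only [hg]; ring
  have hfg : ∀ q k, f q k ≤ g q k := fun q k => (hfg' q k).trans (by
    rw [hg']
    exact mul_le_mul_of_nonneg_right (half_pow_le_inv_succ k) (sq_nonneg _))
  have hf0 : ∀ q k, 0 ≤ f q k := fun q k => by
    have := (h.pos k).le
    simp only [hf]
    positivity
  have hg0 : ∀ q k, 0 ≤ g q k := fun q k => (hf0 q k).trans (hfg q k)
  have hgs : ∀ q, FiniteEntropy q → Summable (g q) := fun q hq =>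
    summable_of_sum_range_le (hg0 q) (sum_mode_sq_div_le_entropy hq)
  have hgle : ∀ q, FiniteEntropy q → ∑' k, g q k ≤ entropy q := fun q hq =>
    Real.tsum_le_of_sum_range_le (hg0 q) (sum_mode_sq_div_le_entropy hq)
  have hfs : ∀ q, FiniteEntropy q → Summable (f q) := fun q hq =>
    Summable.of_nonneg_of_le (hf0 q) (hfg q) (hgs q hq)
  have hKq : ∀ q, K * quad w (mode q) = ∑' k, f q k := by
    intro q
    rw [quad, ← mul_assoc, ← tsum_mul_left]
    exact tsum_congr fun k => by simp only [hf]; ring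
  constructor
  · intro hmin
    have hfin := ((isGlobalMinimizer_iff h K q).1 hmin).1
    have hent := hmin.reducedEnergy_nonpos h
    rw [reducedEnergy, hKq] at hent
    -- for a minimizer both sides of the termwise inequality `f ≤ g` have the same sum
    have hz : ∀ k, g q k - f q k = 0 := by
      have hs := (hgs q hfin).sub (hfs q hfin)
      have h0 : ∑' k, (g q k - f q k) = 0 := by
        refine le_antisymm ?_ (tsum_nonneg fun k => sub_nonneg.2 (hfg q k))
        rw [(hgs q hfin).tsum_sub (hfs q hfin)]
        linarith [hgle q hfin]
      have := (hasSum_zero_iff_of_nonneg fun k => sub_nonneg.2 (hfg q k)).1 (h0 ▸ hs.hasSum)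
      exact fun k => congr_fun this k
    have hm2 : ∀ k, 2 ≤ k → mode q k = 0 := by
      intro k hk
      by_contra hne
      have h1 : 0 < ‖mode q k‖ ^ 2 := by
        have := norm_pos_iff.2 hne
        positivity
      have h2 := mul_lt_mul_of_pos_right (half_pow_lt_inv_succ hk) h1
      have h3 := hfg' q k
      rw [← hg'] at h2
      linarith [hz k]
    have hsum : ∑' k, f q k = f q 0 + f q 1 := by
      rw [tsum_eq_sum (s := Finset.range 2) fun k hk => by
        rw [Finset.mem_range, not_lt] at hk
        simp [hf, hm2 k hk]]
      simp [Finset.sum_range_succ]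
    have h0 := hfg q 0
    have h1 := hfg q 1
    simp only [hg] at h0 h1
    norm_num at h0 h1
    by_cases hm : mode q 0 ≠ 0 ∨ mode q 1 ≠ 0
    · have := sum_mode_sq_div_lt_entropy hfin hm
      linarith
    · push Not at hm
      refine eq_uniform_of_entropy_le_zero hfin ?_
      rw [hsum] at hent
      simp only [hf, hm.1, hm.2] at hent
      simpa using hent
  · rintro rfl
    rw [isGlobalMinimizer_uniform_iff h]
    intro p hp
    rw [reducedEnergy, hKq, sub_nonneg]
    exact ((hfs p hp).tsum_le_tsum (hfg p) (hgs p hp)).trans (hgle p hp)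

end

/-! ### The Fourier series of the transformer kernel -/

lemma cosTwoPi_eq_re (θ : UnitAddCircle) : cosTwoPi θ = (fourier 1 θ).re := by
  induction θ using QuotientAddGroup.induction_on with
  | H x =>
    have e : (2 * Real.pi * Complex.I * (1 : ℤ) * x / (1 : ℝ) : ℂ) =
        ((2 * Real.pi * x : ℝ) : ℂ) * Complex.I := by push_cast; ring
    have h := fourier_coe_apply (T := 1) (n := 1) (x := x)
    rw [e] at h
    refine Eq.trans ?_ (congrArg Complex.re h).symm
    rw [Complex.exp_ofReal_mul_I_re]
    rfl

lemma hasSum_cexp (z : ℂ) : HasSum (fun m : ℕ => z ^ m / (m.factorial : ℂ)) (Complex.exp z) := by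
  have := NormedSpace.expSeries_div_hasSum_exp z
  rwa [← Complex.exp_eq_exp_ℂ] at this

lemma hasSum_mul_prod {f g : ℕ → ℂ} {a b : ℂ} (hf : HasSum f a) (hg : HasSum g b) :
    HasSum (fun x : ℕ × ℕ => f x.1 * g x.2) (a * b) :=
  hf.mul hg (summable_mul_of_summable_norm hf.summable.norm hg.summable.norm)

/-- The generating function `exp (t z) exp (t / z)` of the modified Bessel functions. -/
lemma hasSum_exp_cosTwoPi (t : ℝ) (θ : UnitAddCircle) :
    HasSum (fun x : ℕ × ℕ =>
      ((t ^ (x.1 + x.2) / (x.1.factorial * x.2.factorial) : ℝ) : ℂ) *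
        fourier ((x.1 : ℤ) - x.2) θ) (Real.exp (2 * t * cosTwoPi θ) : ℂ) := by
  obtain ⟨z, hz⟩ : ∃ z : ℂ, fourier 1 θ = z := ⟨_, rfl⟩
  have h1 := hasSum_cexp (t * z)
  have h2 := hasSum_cexp (t * conj z)
  have h := hasSum_mul_prod h1 h2
  have e : (t : ℂ) * z + t * conj z = ((2 * t * cosTwoPi θ : ℝ) : ℂ) := by
    rw [← mul_add, Complex.add_conj, cosTwoPi_eq_re, hz]
    push_cast
    ring
  rw [← Complex.exp_add, e, ← Complex.ofReal_exp] at h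
  have hterm : ∀ x : ℕ × ℕ, ((t ^ (x.1 + x.2) / (x.1.factorial * x.2.factorial) : ℝ) : ℂ) *
      fourier ((x.1 : ℤ) - x.2) θ =
      (t * z) ^ x.1 / (x.1.factorial : ℂ) * ((t * conj z) ^ x.2 / (x.2.factorial : ℂ)) := by
    intro x
    have e2 : fourier ((x.1 : ℤ) - x.2) θ = z ^ x.1 * conj z ^ x.2 := by
      rw [sub_eq_add_neg, fourier_add, fourier_neg, fourier_natCast, fourier_natCast, hz, map_pow]
    rw [e2, mul_pow, mul_pow, Complex.ofReal_div, Complex.ofReal_mul, Complex.ofReal_pow,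
      Complex.ofReal_natCast, Complex.ofReal_natCast, pow_add]
    ring
  simp only [hterm]
  exact h

lemma integral_fourier_mul_exp_cosTwoPi (t : ℝ) (k : ℕ) :
    ∫ θ : UnitAddCircle, fourier (-(k : ℤ)) θ * (Real.exp (2 * t * cosTwoPi θ) : ℂ) =
      besselI k (2 * t) := by
  set b : ℕ × ℕ → ℝ := fun x => t ^ (x.1 + x.2) / (x.1.factorial * x.2.factorial) with hb
  have hbs : Summable fun x => ‖b x‖ := by
    have := (hasSum_exp_cosTwoPi t 0).summable.norm
    simpa only [fourier_eval_zero, mul_one, Complex.norm_real] using this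
  have key := hasSum_integral_of_norm_le (volume : Measure UnitAddCircle)
    (F := fun (x : ℕ × ℕ) θ => fourier (-(k : ℤ)) θ * ((b x : ℂ) * fourier ((x.1 : ℤ) - x.2) θ))
    (fun x => by fun_prop) hbs (fun x θ => by
      rw [norm_mul, norm_mul, norm_fourier_apply, norm_fourier_apply, one_mul, mul_one,
        Complex.norm_real])
  simp only [tsum_mul_left, hb, (hasSum_exp_cosTwoPi t _).tsum_eq] at key
  have hterm : ∀ x : ℕ × ℕ, ∫ θ : UnitAddCircle,
      fourier (-(k : ℤ)) θ * ((b x : ℂ) * fourier ((x.1 : ℤ) - x.2) θ) =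
      if x.1 = x.2 + k then (b x : ℂ) else 0 := by
    intro x
    simp only [mul_left_comm _ (b x : ℂ), fourier_neg]
    rw [integral_const_mul, integral_conj_fourier_mul_fourier]
    by_cases hx : x.1 = x.2 + k
    · rw [if_pos (by omega), if_pos hx, mul_one]
    · rw [if_neg (by omega), if_neg hx, mul_zero]
  simp only [hb] at hterm
  simp only [hterm] at key
  have hinj : Function.Injective fun n : ℕ => (n + k, n) := fun m n hmn => (Prod.ext_iff.1 hmn).2
  rw [← hinj.hasSum_iff (fun x hx => by
    rw [if_neg]
    rintro hx2
    exact hx ⟨x.2, Prod.ext hx2.symm rfl⟩)] at key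
  refine key.tsum_eq.symm.trans ?_
  rw [besselI, Complex.ofReal_tsum]
  refine tsum_congr fun n => ?_
  simp only [Function.comp, if_true]
  congr 2
  · rw [mul_div_cancel_left₀ _ (two_ne_zero' ℝ)]
    congr 1
    omega
  · ring

lemma fourierCoeff_transformerKernel (β : ℝ) {n : ℤ} {k : ℕ} (hk : k ≠ 0)
    (hn : n = k ∨ n = -k) :
    fourierCoeff (fun θ : UnitAddCircle => ((transformerKernel β θ : ℝ) : ℂ)) n =
      ((besselI k β / β : ℝ) : ℂ) := by
  have hcos := continuous_cosTwoPi
  have e : ∀ θ : UnitAddCircle, fourier (-n) θ • ((transformerKernel β θ : ℝ) : ℂ) =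
      (β : ℂ)⁻¹ * (fourier (-n) θ * (Real.exp (β * cosTwoPi θ) : ℂ) - fourier (-n) θ) := by
    intro θ
    simp only [transformerKernel, ContinuousMap.coe_mk, smul_eq_mul, Complex.ofReal_div,
      Complex.ofReal_sub, Complex.ofReal_one]
    ring
  have hE : ∫ θ : UnitAddCircle, fourier (-n) θ * (Real.exp (β * cosTwoPi θ) : ℂ) =
      besselI k β := by
    have h := integral_fourier_mul_exp_cosTwoPi (β / 2) k
    rw [show 2 * (β / 2) = β by ring] at h
    rcases hn with rfl | rfl
    · exact h
    · have h2 := congrArg conj h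
      rw [← integral_conj, Complex.conj_ofReal] at h2
      rw [← h2]
      refine integral_congr_ae (ae_of_all _ fun θ => ?_)
      simp only [map_mul, Complex.conj_ofReal, ← fourier_neg]
  rw [fourierCoeff, AddCircle.integral_haarAddCircle]
  simp only [e, inv_one, one_smul]
  rw [integral_const_mul, integral_sub (integrable_of_continuous (by fun_prop))
    (integrable_of_continuous (by fun_prop)), hE, integral_fourier_volume,
    if_neg (by omega), sub_zero]
  push_cast
  ring

lemma hasPositiveModes_transformerKernel {β : ℝ} (hβ : 0 < β) :
    ∃ c, HasPositiveModes (transformerKernel β) c fun k => besselI (k + 1) β / β := by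
  set V : C(UnitAddCircle, ℂ) := ⟨fun θ => ((transformerKernel β θ : ℝ) : ℂ), by fun_prop⟩ with hV
  set w : ℕ → ℝ := fun k => besselI (k + 1) β / β with hw
  have hsw : Summable w := (summable_besselI_succ hβ).div_const β
  have hpos : ∀ k : ℕ, fourierCoeff V ((k + 1 : ℕ) : ℤ) = (w k : ℂ) := fun k =>
    fourierCoeff_transformerKernel β k.succ_ne_zero (Or.inl rfl)
  have hneg : ∀ k : ℕ, fourierCoeff V (-((k + 1 : ℕ) : ℤ)) = (w k : ℂ) := fun k =>
    fourierCoeff_transformerKernel β k.succ_ne_zero (Or.inr rfl)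
  have hsC : Summable fun k => (w k : ℂ) := Complex.summable_ofReal.2 hsw
  have hs : Summable (fourierCoeff V) := by
    refine Summable.of_nat_of_neg ((summable_nat_add_iff 1).1 ?_) ((summable_nat_add_iff 1).1 ?_)
    · simpa only [hpos] using hsC
    · simpa only [hneg] using hsC
  refine ⟨(fourierCoeff V 0).re, fun k => div_pos (besselI_pos _ hβ) hβ, fun k => ?_, hsw,
    fun θ => ?_⟩
  · exact div_le_div_of_nonneg_right (besselI_succ_le_one k hβ) hβ.le
  · have h1 := (has_pointwise_sum_fourier_series_of_summable hs θ).nat_add_neg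
    have h2 := (hasSum_nat_add_iff' 1).2 h1
    simp only [hpos, hneg, Finset.sum_range_one, Nat.cast_zero, neg_zero, fourier_zero,
      smul_eq_mul, mul_one] at h2
    have h3 := Complex.hasSum_re h2
    convert h3 using 1
    · funext k
      rw [fourier_neg, ← mul_add, Complex.add_conj, ← Complex.ofReal_mul, Complex.ofReal_re,
        Nat.cast_succ]
      ring
    · simp only [Complex.sub_re, Complex.add_re]
      change _ = (((transformerKernel β θ : ℝ) : ℂ)).re + _ - _
      rw [Complex.ofReal_re]
      ring

lemma fourierMode_transformerKernel (β : ℝ) {k : ℕ} (hk : 1 ≤ k) :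
    fourierMode (transformerKernel β) k = besselI k β / β := by
  rw [fourierMode, fourierCoeff_transformerKernel β (by omega) (Or.inl rfl),
    Complex.ofReal_re]

lemma isLinearStabilityThreshold_transformerKernel {β : ℝ} (hβ : 0 < β) :
    IsLinearStabilityThreshold (transformerKernel β) (β / (2 * besselI 1 β)) := by
  have h1 := besselI_pos 1 hβ
  refine ⟨besselI 1 β / β, ⟨⟨1, le_rfl, ?_, (fourierMode_transformerKernel β le_rfl).symm⟩, ?_⟩,
    by field_simp⟩
  · rw [fourierMode_transformerKernel β le_rfl]
    positivity
  · rintro x ⟨k, hk, -, rfl⟩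
    rw [fourierMode_transformerKernel β hk]
    obtain ⟨j, rfl⟩ := Nat.exists_eq_add_of_le' hk
    exact div_le_div_of_nonneg_right (besselI_succ_le_one j hβ) hβ.le

end

end MeanFieldCircle

open MeanFieldCircle

theorem theorem1p6 :
    (∃! b : ℝ, 0 < b ∧ MeanFieldCircle.besselI 2 b = 1 / 2 * MeanFieldCircle.besselI 1 b) ∧
    ∀ βstar : ℝ, 0 < βstar →
      MeanFieldCircle.besselI 2 βstar = 1 / 2 * MeanFieldCircle.besselI 1 βstar →
      ∀ β : ℝ, 0 < β →
        ∃ Kc Ksharp : ℝ,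
          MeanFieldCircle.IsCriticalCoupling (MeanFieldCircle.transformerKernel β) Kc ∧
          MeanFieldCircle.IsLinearStabilityThreshold (MeanFieldCircle.transformerKernel β) Ksharp ∧
          Ksharp = β / (2 * MeanFieldCircle.besselI 1 β) ∧
          (β ≤ βstar → Kc = Ksharp ∧
            MeanFieldCircle.IsContinuousTransition (MeanFieldCircle.transformerKernel β) Kc) ∧
          (βstar < β → Kc < Ksharp ∧
            ¬ MeanFieldCircle.IsContinuousTransition (MeanFieldCircle.transformerKernel β) Kc) := by
  refine ⟨existsUnique_besselI_two_eq_half, fun βstar hstar hroot β hβ => ?_⟩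
  obtain ⟨c, h⟩ := hasPositiveModes_transformerKernel hβ
  have hI := besselI_pos 1 hβ
  set K : ℝ := β / (2 * besselI 1 β) with hK
  have hK0 : 0 < K := by positivity
  have hKw : ∀ k, 2 * K * (besselI (k + 1) β / β) = besselI (k + 1) β / besselI 1 β := by
    intro k
    rw [hK]
    field_simp
  have hKw0 : 2 * K * (besselI (0 + 1) β / β) = 1 := by
    rw [hKw, zero_add, div_self hI.ne']
  have hw0 : 0 < besselI (0 + 1) β / β := h.pos 0
  have hscale : ∀ K', 2 * K' * (besselI (0 + 1) β / β) = K' / K := by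
    intro K'
    rw [eq_div_iff hK0.ne']
    linear_combination K' * hKw0
  obtain ⟨Kc, hKc⟩ := exists_isCriticalCoupling h (K₀ := 2 * K)
    (not_isGlobalMinimizer_uniform_of_one_lt h (by
      rw [hscale, mul_div_assoc, div_self hK0.ne']; norm_num))
  have hle : Kc ≤ K := by
    by_contra hlt
    refine not_isGlobalMinimizer_uniform_of_one_lt h ?_ hKc.critical
    rw [hscale, one_lt_div hK0]
    exact not_le.1 hlt
  have hstar' : besselRatio (βstar / 2) = 1 / 2 := by
    rw [← besselI_two_div_one hstar, hroot, mul_div_cancel_right₀ _ (besselI_pos 1 hstar).ne']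
  have hmono := besselRatio_strictMonoOn.lt_iff_lt (Set.mem_Ici.2 (half_pos hstar).le)
    (Set.mem_Ici.2 (half_pos hβ).le)
  rw [hstar', ← besselI_two_div_one hβ] at hmono
  refine ⟨Kc, K, hKc, isLinearStabilityThreshold_transformerKernel hβ, rfl, fun hβs => ?_,
    fun hβs => ?_⟩
  · have hr : besselI 2 β / besselI 1 β ≤ 1 / 2 := by
      by_contra hlt
      have := hmono.1 (not_le.1 hlt)
      linarith
    have hr0 : 0 ≤ besselI 2 β / besselI 1 β := div_nonneg (besselI_pos 2 hβ).le hI.le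
    have huniq := isGlobalMinimizer_iff_eq_uniform h hK0.le fun k => by
      rw [hKw, div_le_iff₀ hI, mul_comm]
      exact (besselI_le_geometric k hβ).trans (by gcongr)
    have heq : Kc = K := by
      refine hle.antisymm (not_lt.1 fun hlt => ?_)
      obtain ⟨q, hne, hq⟩ := hKc.supercritical K hlt
      exact hne ((huniq q).1 hq)
    rw [heq]
    exact ⟨rfl, isContinuousTransition_of_unique h hK0 huniq⟩
  · have hr : 1 / 2 < besselI 2 β / besselI 1 β := hmono.2 (by linarith)
    have hlt : Kc < K := by
      refine hle.lt_of_ne fun heq => ?_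
      refine not_isGlobalMinimizer_uniform_of_threshold h hKw0 ?_ (heq ▸ hKc.critical)
      rw [hKw]
      exact hr
    refine ⟨hlt, not_isContinuousTransition h hKc ?_⟩
    rw [hscale]
    exact (div_lt_one hK0).2 hlt
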